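/- Let $k\ge 1$, let $Q$ be a smooth $n$-dimensional manifold, and let $\mathrm T^mQ$ be the manifold of $m$-jets at $0$ of curves $\mathbb R\to Q$, with natural coordinates $(q_0^A,\dots,q_m^A)$ and projections $\rho^m_r:\mathrm T^mQ\to\mathrm T^rQ$. Let $\mathcal L\in C^\infty(\mathrm T^kQ)$ and let $$\theta_{\mathcal L}=\sum_{r=1}^k(-1)^{r-1}\frac1{r!}\,d_T^{\,r-1}d_{J_r}\mathcal L\in\Omega^1(\mathrm T^{2k-1}Q),$$ where $d_{J_r}\mathcal L=\mathrm d\mathcal L\circ J_r$, $J_r=\sum_{i=0}^{k-r}\frac{(r+i)!}{i!}\,\mathrm dq_i^A\otimes\frac{\partial}{\partial q_{r+i}^A}$ is the $r$th vertical endomorphism of $\mathrm T(\mathrm T^kQ)$, and $d_T$ is Tulczyjew's (total time) derivation, given by $d_Tf=\sum_i q_{i+1}^A\,\partial f/\partial q_i^A$ on functions and $d_T(\mathrm dq_i^A)=\mathrm dq_{i+1}^A$ (pull-backs to $\mathrm T^{2k-1}Q$ are understood). The Legendre–Ostrogradsky map $\mathcal{FL}:\mathrm T^{2k-1}Q\to\mathrm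 T^*(\mathrm T^{k-1}Q)$ is defined by $\theta_{\mathcal L}(u)=\langle \mathrm T\rho^{2k-1}_{k-1}(u),\mathcal{FL}(p)\rangle$ for $p\in \mathrm T^{2k-1}Q$ and $u\in\mathrm T_p(\mathrm T^{2k-1}Q)$. Let $\mathcal W=\mathrm T^{2k-1}Q\times_{\mathrm T^{k-1}Q}\mathrm T^*(\mathrm T^{k-1}Q)$, with projections $\mathrm{pr}_1,\mathrm{pr}_2$ onto its two factors, let $\Omega=\mathrm{pr}_2^*\omega_{k-1}$, where $\omega_{k-1}=-\mathrm d\theta_{k-1}$ is the canonical symplectic form of $\mathrm T^*(\mathrm T^{k-1}Q)$ ($\theta_{k-1}$ being the canonical $1$-form), and let $H(p,\alpha)=\langle\alpha, j_k(p)\rangle-\mathcal L(\rho^{2k-1}_k(p))$, where $j_k:\mathrm T^{2k-1}Q\to\mathrm T(\mathrm T^{k-1}Q)$ is the canonical injection $j_k(q_0,\dots,q_{2k-1})=(q_0,\dots,q_{k-1};q_1,\dots,q_k)$. Let $\mathcal W_o=\{(p,\mathcal{FL}(p)) : p\in\mathrm T^{2k-1}Q\}\subset\mathcal W$ be the graph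 of $\mathcal{FL}$. Let $X$ be a smooth vector field on $\mathcal W$ at support on $\mathcal W_o$ (a section of $\mathrm T\mathcal W$ over $\mathcal W_o$), tangent to $\mathcal W_o$, with $$\bigl[\,i(X)\Omega-\mathrm dH\,\bigr]\big|_{\mathcal W_o}=0 .$$ Let $X_{\mathcal L}$ be the vector field on $\mathrm T^{2k-1}Q$ determined by $X_{\mathcal L}\circ\mathrm{pr}_1=\mathrm T\mathrm{pr}_1\circ X$ on $\mathcal W_o$, and let $X_h=\mathcal{FL}_*X_{\mathcal L}$, that is, $X_h$ is a vector field on $\mathrm T^*(\mathrm T^{k-1}Q)$ with $X_h\circ\mathcal{FL}=\mathrm T\mathcal{FL}\circ X_{\mathcal L}$. No regularity of $\mathcal L$ is assumed. If $\sigma:I\subset\mathbb R\to\mathcal W$ is an integral curve of $X$ with values in $\mathcal W_o$, then the curve $\sigma_h=\mathcal{FL}\circ\mathrm{pr}_1\circ\sigma: I\to\mathrm T^*(\mathrm T^{k-1}Q)$ is an integral curve of $X_h$. -/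

import Mathlib

open Set Filter Topology Bundle
open scoped Manifold ContDiff

noncomputable section

namespace HigherOrder

/-! ### Jets of curves and the higher-order tangent bundles -/

section Jets

variable {E : Type*} [NormedAddCommGroup E] [NormedSpace ℝ E]

/-- The `i`-th derivative at `0` of a curve read in the chart `e`. -/
def curveCoord {Q : Type*} [TopologicalSpace Q] (e : OpenPartialHomeomorph Q E) (σ : ℝ → Q)
    (i : ℕ) : E :=
  iteratedDeriv i (e ∘ σ) 0

/-- The polynomial curve in `E` whose derivatives at `0` are `q 0, …, q k`. -/
def polyCurve {k : ℕ} (q : Fin (k + 1) → E) (t : ℝ) : E :=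
  ∑ i : Fin (k + 1), ((i : ℕ).factorial : ℝ)⁻¹ • (t ^ (i : ℕ)) • q i

/-- The action of a map `f` between vector spaces on the derivatives of curves of order at most
`k` (formula of Faà di Bruno). -/
def prolong {F : Type*} [NormedAddCommGroup F] [NormedSpace ℝ F] (k : ℕ) (f : E → F)
    (q : Fin (k + 1) → E) : Fin (k + 1) → F := fun i =>
  ∑ c : OrderedFinpartition (i : ℕ), iteratedFDeriv ℝ c.length f (q 0)
    (fun m => q ⟨c.partSize m, (c.partSize_le m).trans_lt i.2⟩)

theorem contDiff_polyCurve {k : ℕ} (q : Fin (k + 1) → E) : ContDiff ℝ ∞ (polyCurve q) := by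
  unfold polyCurve
  fun_prop

theorem iteratedDeriv_polyCurve {k : ℕ} (q : Fin (k + 1) → E) (j : Fin (k + 1)) :
    iteratedDeriv (j : ℕ) (polyCurve q) 0 = q j := by
  unfold polyCurve
  rw [iteratedDeriv_fun_sum (fun i _ => by fun_prop)]
  have : ∀ i : Fin (k + 1), iteratedDeriv (j : ℕ)
      (fun t : ℝ => ((i : ℕ).factorial : ℝ)⁻¹ • (t ^ (i : ℕ)) • q i) 0
      = if i = j then q j else 0 := by
    intro i
    have h1 : (fun t : ℝ => ((i : ℕ).factorial : ℝ)⁻¹ • (t ^ (i : ℕ)) • q i)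
        = fun t : ℝ => ((ContinuousLinearMap.id ℝ ℝ).smulRight
          (((i : ℕ).factorial : ℝ)⁻¹ • q i)) ((fun t : ℝ => t ^ (i : ℕ)) t) := by
      ext t
      simp [smul_smul, mul_comm]
    rw [h1, iteratedDeriv_eq_iteratedFDeriv]
    have h2 := ((ContinuousLinearMap.id ℝ ℝ).smulRight
      (((i : ℕ).factorial : ℝ)⁻¹ • q i)).iteratedFDeriv_comp_left
      (f := fun t : ℝ => t ^ (i : ℕ)) (x := 0) (n := ∞) (by fun_prop) (i := (j : ℕ))
      (by exact_mod_cast le_top)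
    erw [h2]
    simp only [ContinuousLinearMap.compContinuousMultilinearMap_coe, Function.comp_apply,
      ← iteratedDeriv_eq_iteratedFDeriv]
    rw [iteratedDeriv_fun_pow_zero]
    by_cases h : i = j
    · subst h
      simp [smul_smul, Nat.factorial_ne_zero]
    · have : (j : ℕ) ≠ i := fun h' => h (Fin.ext h'.symm)
      simp [h, this]
  simp [this]

theorem polyCurve_zero {k : ℕ} (q : Fin (k + 1) → E) : polyCurve q 0 = q 0 := by
  simpa using iteratedDeriv_polyCurve q 0

theorem contDiffAt_prolong {F : Type*} [NormedAddCommGroup F] [NormedSpace ℝ F] {k : ℕ}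
    {f : E → F} {q : Fin (k + 1) → E} (hf : ContDiffAt ℝ ∞ f (q 0)) :
    ContDiffAt ℝ ∞ (prolong k f) q := by
  rw [contDiffAt_pi]
  intro i
  unfold prolong
  refine ContDiffAt.sum fun c _ => ?_
  have h1 : ContDiffAt ℝ ∞ (fun q : Fin (k + 1) → E => iteratedFDeriv ℝ c.length f (q 0)) q := by
    have : ContDiffAt ℝ ∞ (iteratedFDeriv ℝ c.length f) (q 0) :=
      hf.iteratedFDeriv_right (by rfl)
    exact this.comp q (contDiff_apply ℝ E 0).contDiffAt
  let B : (E [×c.length]→L[ℝ] F) →L[ℝ] ContinuousMultilinearMap ℝ (fun _ : Fin c.length => E) F :=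
    ContinuousLinearMap.id ℝ _
  have h2 := (B.analyticOnNhd_uncurry_of_multilinear (s := univ)).contDiffOn
    (n := ∞) uniqueDiffOn_univ
  rw [contDiffOn_univ] at h2
  exact h2.contDiffAt.comp q (h1.prodMk (contDiffAt_pi.2 fun m => (contDiff_apply ℝ E _).contDiffAt))

variable {Q : Type*} [TopologicalSpace Q] [ChartedSpace E Q]

theorem contDiffAt_chart_comp [IsManifold 𝓘(ℝ, E) ∞ Q] {e : OpenPartialHomeomorph Q E}
    (he : e ∈ atlas E Q) {σ : ℝ → Q} (hσ : ContMDiffAt 𝓘(ℝ, ℝ) 𝓘(ℝ, E) ∞ σ 0)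
    (h0 : σ 0 ∈ e.source) : ContDiffAt ℝ ∞ (e ∘ σ) 0 :=
  contMDiffAt_iff_contDiffAt.1 ((contMDiffAt_of_mem_maximalAtlas
    (IsManifold.subset_maximalAtlas he) h0).comp 0 hσ)

theorem contDiffAt_transition [IsManifold 𝓘(ℝ, E) ∞ Q] {e e' : OpenPartialHomeomorph Q E}
    (he : e ∈ atlas E Q) (he' : e' ∈ atlas E Q) {y : E} (hy : y ∈ e.target)
    (hy' : e.symm y ∈ e'.source) : ContDiffAt ℝ ∞ (e' ∘ e.symm) y :=
  contMDiffAt_iff_contDiffAt.1 ((contMDiffAt_of_mem_maximalAtlas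
    (IsManifold.subset_maximalAtlas he') hy').comp y
    (contMDiffAt_symm_of_mem_maximalAtlas (IsManifold.subset_maximalAtlas he) hy))

/-- Change of charts for the derivatives of a curve. -/
theorem curveCoord_change [IsManifold 𝓘(ℝ, E) ∞ Q] {e e' : OpenPartialHomeomorph Q E}
    (he : e ∈ atlas E Q) (he' : e' ∈ atlas E Q) {σ : ℝ → Q}
    (hσ : ContMDiffAt 𝓘(ℝ, ℝ) 𝓘(ℝ, E) ∞ σ 0) (h0 : σ 0 ∈ e.source) (h0' : σ 0 ∈ e'.source)
    (k : ℕ) (i : Fin (k + 1)) :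
    curveCoord e' σ i = prolong k (e' ∘ e.symm) (fun j => curveCoord e σ j) i := by
  have hev : e' ∘ σ =ᶠ[𝓝 0] (e' ∘ e.symm) ∘ (e ∘ σ) := by
    filter_upwards [hσ.continuousAt.eventually (e.open_source.mem_nhds h0)] with t ht
    simp [e.left_inv ht]
  have h1 := contDiffAt_chart_comp he hσ h0
  have h2 : ContDiffAt ℝ ∞ (e' ∘ e.symm) ((e ∘ σ) 0) :=
    contDiffAt_transition he he' (e.map_source h0) (by simpa [e.left_inv h0] using h0')
  rw [curveCoord, hev.iteratedDeriv_eq,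
    iteratedDeriv_vcomp_eq_sum_orderedFinpartition (n := ∞) h2 h1 (by exact_mod_cast le_top)]
  simp [prolong, curveCoord]

variable (E Q) in
/-- Curves `ℝ → Q` which are smooth near `0`. -/
abbrev SmoothCurve : Type _ := {σ : ℝ → Q // ContMDiffAt 𝓘(ℝ, ℝ) 𝓘(ℝ, E) ∞ σ 0}

/-- Two curves have the same `k`-jet at `0` if they have the same value at `0` and the same
derivatives at `0` up to order `k` in a chart at this point. -/
def jetSetoid (k : ℕ) (E Q : Type*) [NormedAddCommGroup E] [NormedSpace ℝ E] [TopologicalSpace Q]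
    [ChartedSpace E Q] : Setoid (SmoothCurve E Q) where
  r σ τ := σ.1 0 = τ.1 0 ∧ ∀ i : ℕ, i ≤ k →
    curveCoord (chartAt E (σ.1 0)) σ.1 i = curveCoord (chartAt E (σ.1 0)) τ.1 i
  iseqv :=
    { refl := fun _ => ⟨rfl, fun _ _ => rfl⟩
      symm := fun h => ⟨h.1.symm, fun i hi => by rw [← h.1]; exact (h.2 i hi).symm⟩
      trans := fun h h' => ⟨h.1.trans h'.1, fun i hi => (h.2 i hi).trans (by
        rw [h.1]; exact h'.2 i hi)⟩ }

/-- The `k`-th order tangent bundle `T^k Q`: the set of `k`-jets at `0` of curves in `Q`. -/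
def HigherTangent (k : ℕ) (E Q : Type*) [NormedAddCommGroup E] [NormedSpace ℝ E]
    [TopologicalSpace Q] [ChartedSpace E Q] : Type _ := Quotient (jetSetoid k E Q)

namespace HigherTangent

variable {k m r : ℕ}

/-- The `k`-jet at `0` of a curve. -/
def jet (k : ℕ) (σ : SmoothCurve E Q) : HigherTangent k E Q := Quotient.mk (jetSetoid k E Q) σ

/-- The projection `β : T^k Q → Q`. -/
def base (p : HigherTangent k E Q) : Q :=
  Quotient.lift (s := jetSetoid k E Q) (fun σ => σ.1 0) (fun _ _ h => h.1) p

@[simp] theorem base_jet (σ : SmoothCurve E Q) : base (jet k σ) = σ.1 0 := rfl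

/-- The natural coordinates `(q_0, …, q_k)` on `T^k Q` defined by a chart `e` of `Q`
(meaningful if `base p` belongs to the domain of `e`). -/
def coord (e : OpenPartialHomeomorph Q E) (p : HigherTangent k E Q) : Fin (k + 1) → E :=
  fun i => curveCoord e (Quotient.out p).1 i

theorem exists_jet (p : HigherTangent k E Q) : ∃ σ, jet k σ = p := Quotient.exists_rep p

/-- The canonical projection `T^m Q → T^r Q`, `r ≤ m`, as a map. -/
def projFun (h : r ≤ m) (p : HigherTangent m E Q) : HigherTangent r E Q :=
  Quotient.lift (s := jetSetoid m E Q) (fun σ => jet r σ)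
    (fun _ _ h' => Quotient.sound ⟨h'.1, fun i hi => h'.2 i (hi.trans h)⟩) p

theorem projFun_jet (h : r ≤ m) (σ : SmoothCurve E Q) : projFun h (jet m σ) = jet r σ := rfl

@[simp] theorem base_projFun (h : r ≤ m) (p : HigherTangent m E Q) :
    base (projFun h p) = base p := by
  obtain ⟨σ, rfl⟩ := exists_jet p
  rfl

theorem curveCoord_eq_of_jet_eq [IsManifold 𝓘(ℝ, E) ∞ Q] {e : OpenPartialHomeomorph Q E}
    (he : e ∈ atlas E Q) {σ τ : SmoothCurve E Q} (h : jet k σ = jet k τ) (h0 : σ.1 0 ∈ e.source)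
    (i : Fin (k + 1)) : curveCoord e σ.1 i = curveCoord e τ.1 i := by
  have h' : (jetSetoid k E Q).r σ τ := Quotient.exact h
  obtain ⟨h1, h2⟩ := h'
  have hs := mem_chart_source E (σ.1 0)
  rw [curveCoord_change (chart_mem_atlas E (σ.1 0)) he σ.2 hs h0 k i,
    curveCoord_change (chart_mem_atlas E (σ.1 0)) he τ.2 (h1 ▸ hs) (h1 ▸ h0) k i]
  congr 1
  ext j
  exact h2 j (Nat.lt_succ_iff.1 j.2)

theorem jet_eq_of_curveCoord_eq [IsManifold 𝓘(ℝ, E) ∞ Q] {e : OpenPartialHomeomorph Q E}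
    (he : e ∈ atlas E Q) {σ τ : SmoothCurve E Q} (h0 : σ.1 0 ∈ e.source) (h0' : τ.1 0 ∈ e.source)
    (h : ∀ i : Fin (k + 1), curveCoord e σ.1 i = curveCoord e τ.1 i) : jet k σ = jet k τ := by
  have h1 : σ.1 0 = τ.1 0 := e.injOn h0 h0' (by simpa [curveCoord] using h 0)
  refine Quotient.sound (show (jetSetoid k E Q).r σ τ from ⟨h1, fun i hi => ?_⟩)
  have hs := mem_chart_source E (σ.1 0)
  have hi' : i < k + 1 := Nat.lt_succ_of_le hi
  have e1 := curveCoord_change he (chart_mem_atlas E (σ.1 0)) σ.2 h0 hs k ⟨i, hi'⟩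
  have e2 := curveCoord_change he (chart_mem_atlas E (σ.1 0)) τ.2 h0' (h1 ▸ hs) k ⟨i, hi'⟩
  simp only at e1 e2
  rw [e1, e2, funext h]

theorem coord_jet [IsManifold 𝓘(ℝ, E) ∞ Q] {e : OpenPartialHomeomorph Q E}
    (he : e ∈ atlas E Q) {σ : SmoothCurve E Q} (h0 : σ.1 0 ∈ e.source) :
    coord e (jet k σ) = fun i : Fin (k + 1) => curveCoord e σ.1 i := by
  ext i
  have h : jet k (Quotient.out (jet k σ)) = jet k σ := Quotient.out_eq _
  exact (curveCoord_eq_of_jet_eq he h.symm h0 i).symm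

variable [IsManifold 𝓘(ℝ, E) ∞ Q]

/-- The curve in `Q` which is polynomial in the chart `e`, with coordinates `q`. -/
def chartCurve {e : OpenPartialHomeomorph Q E} (he : e ∈ atlas E Q) (q : Fin (k + 1) → E)
    (hq : q 0 ∈ e.target) : SmoothCurve E Q :=
  ⟨e.symm ∘ polyCurve q, by
    have h1 : ContMDiffAt 𝓘(ℝ, E) 𝓘(ℝ, E) ∞ e.symm (polyCurve q 0) :=
      contMDiffAt_symm_of_mem_maximalAtlas (IsManifold.subset_maximalAtlas he)
        (by rwa [polyCurve_zero])
    exact h1.comp 0 (contDiff_polyCurve q).contMDiff.contMDiffAt⟩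

theorem curveCoord_chartCurve {e : OpenPartialHomeomorph Q E} (he : e ∈ atlas E Q)
    (q : Fin (k + 1) → E) (hq : q 0 ∈ e.target) (i : Fin (k + 1)) :
    curveCoord e (chartCurve he q hq).1 i = q i := by
  have hc : ContinuousAt (polyCurve q) 0 := (contDiff_polyCurve q).continuous.continuousAt
  have hev : e ∘ (e.symm ∘ polyCurve q) =ᶠ[𝓝 0] polyCurve q := by
    filter_upwards [hc.eventually (e.open_target.mem_nhds (by rwa [polyCurve_zero]))] with t ht
    simp [e.right_inv ht]
  show iteratedDeriv i (e ∘ (e.symm ∘ polyCurve q)) 0 = q i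
  rw [hev.iteratedDeriv_eq, iteratedDeriv_polyCurve]

theorem chartCurve_zero_mem {e : OpenPartialHomeomorph Q E} (he : e ∈ atlas E Q)
    (q : Fin (k + 1) → E) (hq : q 0 ∈ e.target) : (chartCurve he q hq).1 0 ∈ e.source := by
  show e.symm (polyCurve q 0) ∈ e.source
  rw [polyCurve_zero]
  exact e.map_target hq

open Classical in
/-- The natural chart of `T^k Q` defined by a chart `e` of `Q`. -/
def jetChart (k : ℕ) (e : OpenPartialHomeomorph Q E) (he : e ∈ atlas E Q) :
    PartialEquiv (HigherTangent k E Q) (Fin (k + 1) → E) where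
  toFun := coord e
  invFun q := if hq : q 0 ∈ e.target then jet k (chartCurve he q hq)
    else jet k ⟨fun _ => e.symm (q 0), contMDiffAt_const⟩
  source := {p | base p ∈ e.source}
  target := {q | q 0 ∈ e.target}
  map_source' p hp := by
    obtain ⟨σ, rfl⟩ := exists_jet p
    have h0 : σ.1 0 ∈ e.source := hp
    simp only [mem_ofPred_eq, coord_jet he h0]
    simpa [curveCoord] using e.map_source h0
  map_target' q hq := by
    have hq' : q 0 ∈ e.target := hq
    simp only [mem_ofPred_eq, dif_pos hq', base_jet]
    exact chartCurve_zero_mem he q hq'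
  left_inv' p hp := by
    obtain ⟨σ, rfl⟩ := exists_jet p
    have h0 : σ.1 0 ∈ e.source := hp
    have hq : coord e (jet k σ) 0 ∈ e.target := by
      rw [coord_jet he h0]
      simpa [curveCoord] using e.map_source h0
    rw [dif_pos hq]
    refine jet_eq_of_curveCoord_eq he (chartCurve_zero_mem he _ hq) h0 fun i => ?_
    rw [curveCoord_chartCurve, coord_jet he h0]
  right_inv' q hq := by
    have hq' : q 0 ∈ e.target := hq
    rw [dif_pos hq', coord_jet he (chartCurve_zero_mem he q hq')]
    ext i
    exact curveCoord_chartCurve he q hq' i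

theorem base_jetChart_symm {e : OpenPartialHomeomorph Q E} (he : e ∈ atlas E Q)
    {q : Fin (k + 1) → E} (hq : q 0 ∈ e.target) :
    base ((jetChart k e he).symm q) = e.symm (q 0) := by
  have : (jetChart k e he).symm q = jet k (chartCurve he q hq) := dif_pos hq
  rw [this, base_jet]
  show e.symm (polyCurve q 0) = _
  rw [polyCurve_zero]

theorem jetChart_trans_source {e e' : OpenPartialHomeomorph Q E} (he : e ∈ atlas E Q)
    (he' : e' ∈ atlas E Q) : ((jetChart k e he).symm.trans (jetChart k e' he')).source
      = (fun q : Fin (k + 1) → E => q 0) ⁻¹' (e.target ∩ e.symm ⁻¹' e'.source) := by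
  ext q
  simp only [PartialEquiv.trans_source, PartialEquiv.symm_source, mem_inter_iff, mem_preimage]
  show q 0 ∈ e.target ∧ base ((jetChart k e he).symm q) ∈ e'.source ↔ _
  refine and_congr_right fun hq => ?_
  rw [base_jetChart_symm he hq]

theorem jetChart_trans_apply {e e' : OpenPartialHomeomorph Q E} (he : e ∈ atlas E Q)
    (he' : e' ∈ atlas E Q) {q : Fin (k + 1) → E}
    (hq : q ∈ ((jetChart k e he).symm.trans (jetChart k e' he')).source) :
    ((jetChart k e he).symm.trans (jetChart k e' he')) q = prolong k (e' ∘ e.symm) q := by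
  rw [jetChart_trans_source] at hq
  obtain ⟨h1, h2⟩ := hq
  have h3 : (jetChart k e he).symm q = jet k (chartCurve he q h1) := dif_pos h1
  have h4 : (chartCurve he q h1).1 0 ∈ e'.source := by
    show e.symm (polyCurve q 0) ∈ e'.source
    rw [polyCurve_zero]
    exact h2
  show coord e' ((jetChart k e he).symm q) = _
  rw [h3, coord_jet he' h4]
  ext i
  rw [curveCoord_change he he' (chartCurve he q h1).2 (chartCurve_zero_mem he q h1) h4 k i]
  congr 1
  ext j
  exact curveCoord_chartCurve he q h1 j

theorem contDiffOn_jetChart_trans {e e' : OpenPartialHomeomorph Q E} (he : e ∈ atlas E Q)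
    (he' : e' ∈ atlas E Q) :
    ContDiffOn ℝ ∞ ((jetChart k e he).symm.trans (jetChart k e' he'))
      ((jetChart k e he).symm.trans (jetChart k e' he')).source := by
  have : ContDiffOn ℝ ∞ (prolong k (e' ∘ e.symm))
      ((jetChart k e he).symm.trans (jetChart k e' he')).source := by
    intro q hq
    rw [jetChart_trans_source] at hq
    exact (contDiffAt_prolong (contDiffAt_transition he he' hq.1 hq.2)).contDiffWithinAt
  exact this.congr fun q hq => jetChart_trans_apply he he' hq

theorem isOpen_jetChart_trans_source {e e' : OpenPartialHomeomorph Q E} (he : e ∈ atlas E Q)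
    (he' : e' ∈ atlas E Q) :
    IsOpen ((jetChart k e he).symm.trans (jetChart k e' he')).source := by
  rw [jetChart_trans_source]
  exact (e.isOpen_inter_preimage_symm e'.open_source).preimage (continuous_apply 0)

variable (E Q) in
/-- The natural charts give `T^k Q` its topology and its charted space structure. -/
def core (k : ℕ) : ChartedSpaceCore (Fin (k + 1) → E) (HigherTangent k E Q) where
  atlas := {f | ∃ (e : OpenPartialHomeomorph Q E) (he : e ∈ atlas E Q), f = jetChart k e he}
  chartAt p := jetChart k (chartAt E (base p)) (chart_mem_atlas E _)
  mem_chart_source p := mem_chart_source E (base p)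
  chart_mem_atlas p := ⟨_, chart_mem_atlas E _, rfl⟩
  open_source := by
    rintro _ _ ⟨e, he, rfl⟩ ⟨e', he', rfl⟩
    exact isOpen_jetChart_trans_source he he'
  continuousOn_toFun := by
    rintro _ _ ⟨e, he, rfl⟩ ⟨e', he', rfl⟩
    exact (contDiffOn_jetChart_trans he he').continuousOn

instance : TopologicalSpace (HigherTangent k E Q) := (core E Q k).toTopologicalSpace

instance : ChartedSpace (Fin (k + 1) → E) (HigherTangent k E Q) := (core E Q k).toChartedSpace

theorem mem_atlas_iff {f : OpenPartialHomeomorph (HigherTangent k E Q) (Fin (k + 1) → E)} :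
    f ∈ atlas (Fin (k + 1) → E) (HigherTangent k E Q) ↔
      ∃ (g : PartialEquiv (HigherTangent k E Q) (Fin (k + 1) → E)) (hg : g ∈ (core E Q k).atlas),
        f = (core E Q k).openPartialHomeomorph g hg := by
  show f ∈ ⋃ (g : PartialEquiv (HigherTangent k E Q) (Fin (k + 1) → E))
    (hg : g ∈ (core E Q k).atlas), {(core E Q k).openPartialHomeomorph g hg} ↔ _
  simp only [mem_iUnion, mem_singleton_iff]

instance : IsManifold 𝓘(ℝ, Fin (k + 1) → E) ∞ (HigherTangent k E Q) := by
  refine isManifold_of_contDiffOn _ _ _ ?_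
  intro f f' hf hf'
  obtain ⟨g, hg, rfl⟩ := mem_atlas_iff.1 hf
  obtain ⟨g', hg', rfl⟩ := mem_atlas_iff.1 hf'
  obtain ⟨e, he, rfl⟩ := hg
  obtain ⟨e', he', rfl⟩ := hg'
  have := contDiffOn_jetChart_trans (k := k) he he'
  simpa using! this

/-- The chart of `T^k Q` at `p` is given by the natural coordinates defined by the chart of `Q`
at `base p`. -/
theorem chartAt_apply (p p' : HigherTangent k E Q) :
    chartAt (Fin (k + 1) → E) p p' = coord (chartAt E (base p)) p' := rfl

theorem chartAt_source (p : HigherTangent k E Q) :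
    (chartAt (Fin (k + 1) → E) p).source = {p' | base p' ∈ (chartAt E (base p)).source} := rfl

theorem chartAt_target (p : HigherTangent k E Q) :
    (chartAt (Fin (k + 1) → E) p).target = {q | q 0 ∈ (chartAt E (base p)).target} := rfl

variable (E) in
/-- Truncation of the coordinates `(v_0, …, v_m)` to `(v_0, …, v_r)`. -/
def trunc (h : r ≤ m) : (Fin (m + 1) → E) →L[ℝ] (Fin (r + 1) → E) :=
  ContinuousLinearMap.pi fun i =>
    ContinuousLinearMap.proj (R := ℝ) (φ := fun _ => E) (Fin.castLE (Nat.succ_le_succ h) i)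

theorem coord_projFun (h : r ≤ m) {e : OpenPartialHomeomorph Q E} (he : e ∈ atlas E Q)
    {p : HigherTangent m E Q} (hp : base p ∈ e.source) :
    coord e (projFun h p) = trunc E h (coord e p) := by
  obtain ⟨σ, rfl⟩ := exists_jet p
  rw [projFun_jet, coord_jet he hp, coord_jet he hp]
  rfl

theorem contMDiff_projFun (h : r ≤ m) :
    ContMDiff 𝓘(ℝ, Fin (m + 1) → E) 𝓘(ℝ, Fin (r + 1) → E) ∞
      (projFun h : HigherTangent m E Q → HigherTangent r E Q) := by
  intro p
  have he := chart_mem_atlas E (base p)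
  have h1 : ContMDiffAt 𝓘(ℝ, Fin (m + 1) → E) 𝓘(ℝ, Fin (m + 1) → E) ∞
      (chartAt (Fin (m + 1) → E) p) p :=
    contMDiffAt_of_mem_maximalAtlas (IsManifold.chart_mem_maximalAtlas p) (mem_chart_source _ p)
  have h2 := (trunc E h).contMDiff.contMDiffAt.comp p h1 (n := ∞)
  have h3 : trunc E h (chartAt (Fin (m + 1) → E) p p)
      ∈ (chartAt (Fin (r + 1) → E) (projFun h p)).target := by
    rw [chartAt_apply, ← coord_projFun h he (mem_chart_source E (base p)), ← base_projFun h p,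
      ← chartAt_apply]
    exact mem_chart_target _ _
  have h4 := (contMDiffAt_symm_of_mem_maximalAtlas (I := 𝓘(ℝ, Fin (r + 1) → E)) (n := ∞)
    (IsManifold.chart_mem_maximalAtlas (projFun h p)) h3).comp p h2
  refine h4.congr_of_eventuallyEq ?_
  filter_upwards [(chartAt (Fin (m + 1) → E) p).open_source.mem_nhds (mem_chart_source _ p)]
    with p' hp'
  have hp'' : projFun h p' ∈ (chartAt (Fin (r + 1) → E) (projFun h p)).source := by
    rw [chartAt_source] at hp' ⊢
    simpa using hp'
  have h5 : trunc E h (chartAt (Fin (m + 1) → E) p p')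
      = chartAt (Fin (r + 1) → E) (projFun h p) (projFun h p') := by
    rw [chartAt_apply, chartAt_apply, base_projFun, coord_projFun h he hp']
  simp only [Function.comp_apply]
  rw [h5, OpenPartialHomeomorph.left_inv _ hp'']

variable (E Q) in
/-- The canonical projection `ρ : T^m Q → T^r Q`, `r ≤ m`, as a smooth map. -/
def proj (h : r ≤ m) : C^∞⟮𝓘(ℝ, Fin (m + 1) → E), HigherTangent m E Q;
    𝓘(ℝ, Fin (r + 1) → E), HigherTangent r E Q⟯ :=
  ⟨projFun h, contMDiff_projFun h⟩

/-- In natural coordinates, the tangent map of the projection is the truncation. -/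
theorem mfderiv_proj (h : r ≤ m) (p : HigherTangent m E Q) :
    mfderiv 𝓘(ℝ, Fin (m + 1) → E) 𝓘(ℝ, Fin (r + 1) → E) (proj E Q h) p = trunc E h := by
  have hd : MDifferentiableAt 𝓘(ℝ, Fin (m + 1) → E) 𝓘(ℝ, Fin (r + 1) → E) (proj E Q h) p :=
    (proj E Q h).contMDiff.mdifferentiable (by simp) p
  rw [hd.mfderiv]
  have hev : writtenInExtChartAt 𝓘(ℝ, Fin (m + 1) → E) 𝓘(ℝ, Fin (r + 1) → E) p (proj E Q h)
      =ᶠ[𝓝 (extChartAt 𝓘(ℝ, Fin (m + 1) → E) p p)] trunc E h := by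
    filter_upwards [extChartAt_target_mem_nhds (I := 𝓘(ℝ, Fin (m + 1) → E)) p] with y hy
    have hy' : y ∈ (chartAt (Fin (m + 1) → E) p).target := by simpa using hy
    have h1 := (chartAt (Fin (m + 1) → E) p).map_target hy'
    have h2 := coord_projFun h (chart_mem_atlas E (base p)) h1
    have h3 := (chartAt (Fin (m + 1) → E) p).right_inv hy'
    rw [chartAt_apply] at h3
    rw [h3, ← base_projFun h p, ← chartAt_apply] at h2
    exact h2
  simp only [modelWithCornersSelf_coe, range_id, fderivWithin_univ]
  rw [hev.fderiv_eq]
  exact (trunc E h).fderiv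

/-- The canonical injection `j : T^m Q → T (T^r Q)`, `r + 1 ≤ m`. Its value at the `m`-jet of `σ` is
the velocity at `t = 0` of the curve `t ↦ (r-jet at 0 of s ↦ σ (s + t))`; in natural coordinates
`j (q_0, …, q_m) = (q_0, …, q_r; q_1, …, q_{r+1})`. -/
def inj (h : r + 1 ≤ m) (p : HigherTangent m E Q) :
    TangentSpace 𝓘(ℝ, Fin (r + 1) → E) (proj E Q (Nat.le_of_succ_le h) p) :=
  fun i : Fin (r + 1) => coord (chartAt E (base p)) p
    ⟨(i : ℕ) + 1, Nat.succ_lt_succ (i.2.trans_le h)⟩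

end HigherTangent

end Jets

/-! ### Differential forms of degree one and the canonical forms of a cotangent bundle -/

section Forms

variable {F : Type*} [NormedAddCommGroup F] [NormedSpace ℝ F] {H : Type*} [TopologicalSpace H]
  (I : ModelWithCorners ℝ F H) (M : Type*) [TopologicalSpace M] [ChartedSpace H M]

/-- Differential `1`-forms (no regularity is imposed) on a manifold. -/
abbrev OneForm : Type _ := (p : M) → TangentSpace I p →L[ℝ] ℝ

/-- The cotangent bundle of a manifold. -/
abbrev Cotangent : Type _ := TotalSpace (F →L[ℝ] ℝ) (fun p : M => TangentSpace I p →L[ℝ] ℝ)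

variable {I M}

/-- The expression of a `1`-form in the preferred chart at `p` (for manifolds without boundary). -/
def OneForm.inChart (θ : OneForm I M) (p : M) (y : F) : F →L[ℝ] ℝ :=
  (θ ((extChartAt I p).symm y)).comp (mfderiv 𝓘(ℝ, F) I (extChartAt I p).symm y)

/-- The exterior derivative of a `1`-form `θ = ∑ θ_i dx^i` (on a manifold without boundary),
`dθ (u, v) = ∑ (∂_j θ_i) (u^j v^i - v^j u^i)`, computed at `p` in the preferred chart at `p`. -/
def OneForm.extDeriv (θ : OneForm I M) (p : M) (u v : TangentSpace I p) : ℝ :=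
  fderiv ℝ (θ.inChart p) (extChartAt I p p) u v - fderiv ℝ (θ.inChart p) (extChartAt I p p) v u

variable (I M) in
/-- The canonical (Liouville) `1`-form of the cotangent bundle: `θ_α (u) = α (Tπ u)`. -/
def canonicalOneForm [IsManifold I ∞ M] : OneForm (I.prod 𝓘(ℝ, F →L[ℝ] ℝ)) (Cotangent I M) :=
  fun α => α.2.comp (mfderiv (I.prod 𝓘(ℝ, F →L[ℝ] ℝ)) I (fun β : Cotangent I M => β.proj) α)

variable (I M) in
/-- The canonical symplectic form `ω = -dθ` of the cotangent bundle. -/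
def canonicalTwoForm [IsManifold I ∞ M] (α : Cotangent I M)
    (u v : TangentSpace (I.prod 𝓘(ℝ, F →L[ℝ] ℝ)) α) : ℝ :=
  -(canonicalOneForm I M).extDeriv α u v

end Forms

/-! ### Lagrangian formalism of order `k` -/

section Lagrangian

open HigherTangent

variable {E : Type*} [NormedAddCommGroup E] [NormedSpace ℝ E]
  {Q : Type*} [TopologicalSpace Q] [ChartedSpace E Q] [IsManifold 𝓘(ℝ, E) ∞ Q]

variable (E Q) in
/-- `1`-forms on `T^m Q`. -/
abbrev JetForm (m : ℕ) : Type _ := OneForm 𝓘(ℝ, Fin (m + 1) → E) (HigherTangent m E Q)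

variable (E) in
/-- The shift `(v_0, …, v_{m+1}) ↦ (v_1, …, v_{m+1})`. -/
def shift (m : ℕ) : (Fin (m + 2) → E) →L[ℝ] (Fin (m + 1) → E) :=
  ContinuousLinearMap.pi fun i =>
    ContinuousLinearMap.proj (R := ℝ) (φ := fun _ => E) (Fin.succ i)

/-- The `r`-th vertical endomorphism `J_r` of `T (T^m Q)`: in natural coordinates,
`(J_r v)_i = i! / (i - r)! v_{i-r}` for `i ≥ r` and `(J_r v)_i = 0` for `i < r`. -/
def verticalEndomorphism {m : ℕ} (r : ℕ) (p : HigherTangent m E Q) :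
    TangentSpace 𝓘(ℝ, Fin (m + 1) → E) p →L[ℝ] TangentSpace 𝓘(ℝ, Fin (m + 1) → E) p :=
  ContinuousLinearMap.pi (R := ℝ) (M := Fin (m + 1) → E) (φ := fun _ : Fin (m + 1) => E) fun i =>
    if r ≤ (i : ℕ) then
      (((i : ℕ).descFactorial r : ℕ) : ℝ) • ContinuousLinearMap.proj (R := ℝ) (φ := fun _ => E)
        (⟨(i : ℕ) - r, (Nat.sub_le _ _).trans_lt i.2⟩ : Fin (m + 1))
    else 0

/-- The `r`-th vertical differential of a function: `d_{J_r} f = df ∘ J_r`. -/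
def verticalDifferential {m : ℕ} (r : ℕ) (f : HigherTangent m E Q → ℝ) : JetForm E Q m :=
  fun p => ContinuousLinearMap.comp
    (mfderiv 𝓘(ℝ, Fin (m + 1) → E) 𝓘(ℝ, ℝ) f p :
      TangentSpace 𝓘(ℝ, Fin (m + 1) → E) p →L[ℝ] ℝ) (verticalEndomorphism r p)

/-- Tulczyjew's derivation on `1`-forms, from `T^m Q` to `T^{m+1} Q`. It is the derivation with
`(d_T f) (p) = df (j p)` and `d_T (dq_i) = dq_{i+1}`; that is, in natural coordinates,
`d_T (∑ a_i dq_i) = ∑ (d_T a_i) dq_i + ∑ a_i dq_{i+1}`. -/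
def tulczyjew {m : ℕ} (η : JetForm E Q m) : JetForm E Q (m + 1) := fun p =>
  let q := proj E Q (Nat.le_succ m) p
  ContinuousLinearMap.comp
      (fderiv ℝ (η.inChart q) (extChartAt 𝓘(ℝ, Fin (m + 1) → E) q q) (inj le_rfl p))
      (trunc E (Nat.le_succ m))
    + ContinuousLinearMap.comp (η q : (Fin (m + 1) → E) →L[ℝ] ℝ) (shift E m)

/-- The iterates `d_T^s` of Tulczyjew's derivation. -/
def tulczyjewIter {m : ℕ} (η : JetForm E Q m) : (s : ℕ) → JetForm E Q (m + s)
  | 0 => η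
  | s + 1 => tulczyjew (tulczyjewIter η s)

/-- The pull-back of a `1`-form by the projection `T^m Q → T^r Q`. -/
def pullbackForm {m r : ℕ} (h : r ≤ m) (η : JetForm E Q r) : JetForm E Q m := fun p =>
  (η (proj E Q h p)).comp
    (mfderiv 𝓘(ℝ, Fin (m + 1) → E) 𝓘(ℝ, Fin (r + 1) → E) (proj E Q h) p)

variable (E Q) in
/-- Lagrangian functions of order `k`. -/
abbrev LagrangianFunction (k : ℕ) : Type _ :=
  C^∞⟮𝓘(ℝ, Fin (k + 1) → E), HigherTangent k E Q; 𝓘(ℝ, ℝ), ℝ⟯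

variable {k m r : ℕ}

/-- The Lagrangian `1`-form
`θ_L = ∑_{r=1}^k (-1)^{r-1} (1 / r!) d_T^{r-1} d_{J_r} L` on `T^{2k-1} Q` (with `r = s + 1`). -/
def lagrangianForm (L : LagrangianFunction E Q k) : JetForm E Q (2 * k - 1) := fun p =>
  ∑ s : Fin k, ((-1 : ℝ) ^ (s : ℕ) * (((s : ℕ) + 1).factorial : ℝ)⁻¹) •
    pullbackForm (show k + (s : ℕ) ≤ 2 * k - 1 by have := s.2; omega)
      (tulczyjewIter (verticalDifferential ((s : ℕ) + 1) L) s) p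

variable (E Q) in
/-- The cotangent bundle `T^* (T^{k-1} Q)`. -/
abbrev PhaseSpace (k : ℕ) : Type _ :=
  Cotangent 𝓘(ℝ, Fin (k - 1 + 1) → E) (HigherTangent (k - 1) E Q)

variable (E) in
/-- The model of `T^* (T^{k-1} Q)`. -/
abbrev phaseModel (k : ℕ) :=
  𝓘(ℝ, Fin (k - 1 + 1) → E).prod 𝓘(ℝ, (Fin (k - 1 + 1) → E) →L[ℝ] ℝ)

variable (k) in
theorem sub_one_le_two_mul_sub_one : k - 1 ≤ 2 * k - 1 := by omega

variable (E Q k) in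
/-- The projection `T^{2k-1} Q → T^{k-1} Q`. -/
abbrev rho : C^∞⟮𝓘(ℝ, Fin (2 * k - 1 + 1) → E), HigherTangent (2 * k - 1) E Q;
    𝓘(ℝ, Fin (k - 1 + 1) → E), HigherTangent (k - 1) E Q⟯ :=
  proj E Q (sub_one_le_two_mul_sub_one k)

variable (E) in
/-- Extension by zero `(v_0, …, v_r) ↦ (v_0, …, v_r, 0, …, 0)`. -/
def extendZero (r m : ℕ) : (Fin (r + 1) → E) →L[ℝ] (Fin (m + 1) → E) :=
  ContinuousLinearMap.pi fun i =>
    if h : (i : ℕ) < r + 1 then ContinuousLinearMap.proj (R := ℝ) (φ := fun _ => E) ⟨i, h⟩ else 0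

/-- The Legendre-Ostrogradsky map `FL : T^{2k-1} Q → T^* (T^{k-1} Q)`, characterized by
`θ_L (u) = ⟨Tρ (u), FL (τ u)⟩`. -/
def legendre (L : LagrangianFunction E Q k) (p : HigherTangent (2 * k - 1) E Q) :
    PhaseSpace E Q k :=
  ⟨rho E Q k p, ContinuousLinearMap.comp
    (lagrangianForm L p : (Fin (2 * k - 1 + 1) → E) →L[ℝ] ℝ)
    (extendZero E (k - 1) (2 * k - 1))⟩

/-- A `1`-form on `T^m Q` vanishing on the vectors `v` with `v_0 = … = v_j = 0` (in natural
coordinates). -/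
def IsSemibasic {m : ℕ} (j : ℕ) (η : JetForm E Q m) : Prop :=
  ∀ (p : HigherTangent m E Q) (v : Fin (m + 1) → E), (∀ i : Fin (m + 1), (i : ℕ) ≤ j → v i = 0) →
    η p v = 0

theorem mfderiv_chart_symm_zero {j : ℕ} (hj : j ≤ m) (p : HigherTangent m E Q)
    {y : Fin (m + 1) → E}
    (hy : y ∈ (extChartAt 𝓘(ℝ, Fin (m + 1) → E) p).target) (v : Fin (m + 1) → E)
    (hv : trunc E hj v = 0) :
    trunc E hj (mfderiv 𝓘(ℝ, Fin (m + 1) → E) 𝓘(ℝ, Fin (m + 1) → E)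
      (extChartAt 𝓘(ℝ, Fin (m + 1) → E) p).symm y v) = 0 := by
  have hy' : y ∈ (chartAt (Fin (m + 1) → E) p).target := by simpa using hy
  set q := proj E Q hj p
  have hbq : base q = base p := base_projFun hj p
  have hs : MDifferentiableAt 𝓘(ℝ, Fin (m + 1) → E) 𝓘(ℝ, Fin (m + 1) → E)
      (extChartAt 𝓘(ℝ, Fin (m + 1) → E) p).symm y :=
    ((contMDiffOn_extChartAt_symm p).contMDiffAt
      (by exact (isOpen_extChartAt_target p).mem_nhds hy)).mdifferentiableAt
      (n := ∞) (by simp)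
  have hty : trunc E hj y ∈ (extChartAt 𝓘(ℝ, Fin (j + 1) → E) q).target := by
    have : y 0 ∈ (chartAt E (base p)).target := hy'
    rw [← hbq] at this
    have h' : trunc E hj y ∈ (chartAt (Fin (j + 1) → E) q).target := this
    simpa using h'
  have hs' : MDifferentiableAt 𝓘(ℝ, Fin (j + 1) → E) 𝓘(ℝ, Fin (j + 1) → E)
      (extChartAt 𝓘(ℝ, Fin (j + 1) → E) q).symm (trunc E hj y) :=
    ((contMDiffOn_extChartAt_symm q).contMDiffAt
      (by exact (isOpen_extChartAt_target q).mem_nhds hty)).mdifferentiableAt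
      (n := ∞) (by simp)
  have hp : MDifferentiableAt 𝓘(ℝ, Fin (m + 1) → E) 𝓘(ℝ, Fin (j + 1) → E) (proj E Q hj)
      ((extChartAt 𝓘(ℝ, Fin (m + 1) → E) p).symm y) :=
    (proj E Q hj).contMDiff.mdifferentiable (by simp) _
  have e1 := mfderiv_comp y hp hs
  have e2 := mfderiv_comp y hs' ((trunc E hj).mdifferentiableAt)
  have hev : (proj E Q hj) ∘ (extChartAt 𝓘(ℝ, Fin (m + 1) → E) p).symm =ᶠ[𝓝 y]
      (extChartAt 𝓘(ℝ, Fin (j + 1) → E) q).symm ∘ (trunc E hj) := by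
    filter_upwards [(isOpen_extChartAt_target p).mem_nhds hy] with z hz
    have hz' : z ∈ (chartAt (Fin (m + 1) → E) p).target := by simpa using hz
    have h1 := (chartAt (Fin (m + 1) → E) p).map_target hz'
    have h2 := coord_projFun hj (chart_mem_atlas E (base p)) h1
    have h3 := (chartAt (Fin (m + 1) → E) p).right_inv hz'
    rw [chartAt_apply] at h3
    rw [h3, ← hbq, ← chartAt_apply] at h2
    have h4 : projFun hj ((chartAt (Fin (m + 1) → E) p).symm z)
        ∈ (chartAt (Fin (j + 1) → E) q).source := by
      rw [chartAt_source]
      show base (projFun hj _) ∈ (chartAt E (base q)).source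
      rw [base_projFun, hbq]
      exact h1
    have h5 := (chartAt (Fin (j + 1) → E) q).left_inv h4
    rw [h2] at h5
    exact h5.symm
  rw [hev.mfderiv_eq, e2] at e1
  have e3 := DFunLike.congr_fun e1 v
  rw [mfderiv_proj] at e3
  refine e3.symm.trans ?_
  have e4 : mfderiv 𝓘(ℝ, Fin (m + 1) → E) 𝓘(ℝ, Fin (j + 1) → E) (trunc E hj) y v = 0 := by
    rw [(trunc E hj).mfderiv_eq]
    exact hv
  show (mfderiv 𝓘(ℝ, Fin (j + 1) → E) 𝓘(ℝ, Fin (j + 1) → E)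
    (extChartAt 𝓘(ℝ, Fin (j + 1) → E) q).symm (trunc E hj y))
      (mfderiv 𝓘(ℝ, Fin (m + 1) → E) 𝓘(ℝ, Fin (j + 1) → E) (trunc E hj) y v) = 0
  rw [e4]
  exact map_zero _

theorem trunc_eq_zero {j : ℕ} (hj : j ≤ m) {v : Fin (m + 1) → E} :
    trunc E hj v = 0 ↔ ∀ i : Fin (m + 1), (i : ℕ) ≤ j → v i = 0 := by
  constructor
  · intro h i hi
    exact congrFun h ⟨i, Nat.lt_succ_of_le hi⟩
  · intro h
    ext i
    exact h _ (Nat.lt_succ_iff.1 i.2)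

theorem IsSemibasic.tulczyjew {j : ℕ} (hj : j ≤ m) {η : JetForm E Q m} (h : IsSemibasic j η) :
    IsSemibasic (j + 1) (tulczyjew η) := by
  intro p v hv
  set q := proj E Q (Nat.le_succ m) p
  have h1 : η q (shift E m v) = 0 := h q _ fun i hi => hv i.succ (by simpa using hi)
  have h2 : ∀ u, fderiv ℝ (η.inChart q) (extChartAt 𝓘(ℝ, Fin (m + 1) → E) q q) u
      (trunc E (Nat.le_succ m) v) = 0 := by
    intro u
    set w := trunc E (Nat.le_succ m) v with hw
    have hw0 : trunc E hj w = 0 := by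
      rw [trunc_eq_zero]
      intro i hi
      exact hv (Fin.castLE (Nat.succ_le_succ (Nat.le_succ m)) i) (by
        simp only [Fin.val_castLE]; omega)
    by_cases hd : DifferentiableAt ℝ (η.inChart q) (extChartAt 𝓘(ℝ, Fin (m + 1) → E) q q)
    · have hc := (hd.hasFDerivAt.clm_apply (hasFDerivAt_const w _)).fderiv
      have hz : (fun y => η.inChart q y w)
          =ᶠ[𝓝 (extChartAt 𝓘(ℝ, Fin (m + 1) → E) q q)] fun _ => (0 : ℝ) := by
        filter_upwards [extChartAt_target_mem_nhds (I := 𝓘(ℝ, Fin (m + 1) → E)) q] with y hy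
        exact h _ _ ((trunc_eq_zero hj).1 (mfderiv_chart_symm_zero hj q hy w hw0))
      have hc' := hz.fderiv_eq (𝕜 := ℝ)
      rw [hc] at hc'
      simpa using DFunLike.congr_fun hc' u
    · rw [fderiv_zero_of_not_differentiableAt hd]
      rfl
  have h3 := h2 (inj le_rfl p)
  show (fderiv ℝ (η.inChart q) (extChartAt 𝓘(ℝ, Fin (m + 1) → E) q q) (inj le_rfl p))
      (trunc E (Nat.le_succ m) v) + η q (shift E m v) = (0 : ℝ)
  rw [h1, h3, add_zero]

theorem isSemibasic_verticalDifferential (hr : r ≤ m) (f : HigherTangent m E Q → ℝ) :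
    IsSemibasic (m - r) (verticalDifferential r f) := by
  intro p v hv
  have : verticalEndomorphism r p v = (0 : Fin (m + 1) → E) := by
    refine funext fun i => ?_
    show (if r ≤ (i : ℕ) then (((i : ℕ).descFactorial r : ℕ) : ℝ) •
      ContinuousLinearMap.proj (R := ℝ) (φ := fun _ => E)
        (⟨(i : ℕ) - r, (Nat.sub_le _ _).trans_lt i.2⟩ : Fin (m + 1)) else 0) v = 0
    split_ifs with hi
    · have := hv ⟨(i : ℕ) - r, (Nat.sub_le _ _).trans_lt i.2⟩ (by
        have := i.2
        simp only
        omega)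
      simp [this]
    · simp
  show mfderiv 𝓘(ℝ, Fin (m + 1) → E) 𝓘(ℝ, ℝ) f p (verticalEndomorphism r p v) = 0
  rw [this]
  exact map_zero _

theorem isSemibasic_tulczyjewIter {j : ℕ} (hj : j ≤ m) {η : JetForm E Q m} (h : IsSemibasic j η)
    (s : ℕ) : IsSemibasic (j + s) (tulczyjewIter η s) := by
  induction s with
  | zero => exact h
  | succ s ih => exact IsSemibasic.tulczyjew (Nat.add_le_add_right hj s) ih

theorem lagrangianForm_eq_zero (L : LagrangianFunction E Q k) (p : HigherTangent (2 * k - 1) E Q)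
    (v : Fin (2 * k - 1 + 1) → E) (hv : ∀ i : Fin (2 * k - 1 + 1), (i : ℕ) ≤ k - 1 → v i = 0) :
    lagrangianForm L p v = 0 := by
  have : ∀ s : Fin k, pullbackForm (show k + (s : ℕ) ≤ 2 * k - 1 by have := s.2; omega)
      (tulczyjewIter (verticalDifferential ((s : ℕ) + 1) L) s) p v = 0 := by
    intro s
    have hs := isSemibasic_tulczyjewIter (Nat.sub_le _ _)
      (isSemibasic_verticalDifferential (Nat.succ_le_of_lt s.2) L) s
    refine hs _ _ fun i hi => ?_
    erw [mfderiv_proj]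
    refine hv _ ?_
    have := s.2
    simp only [Fin.val_castLE]
    omega
  unfold lagrangianForm
  erw [sum_apply]
  refine Finset.sum_eq_zero fun s _ => ?_
  erw [smul_apply, this s, smul_zero]

/-- The identity `θ_L (u) = ⟨Tρ (u), FL (τ u)⟩` which characterizes the Legendre-Ostrogradsky
map. -/
theorem lagrangianForm_eq (L : LagrangianFunction E Q k) (p : HigherTangent (2 * k - 1) E Q)
    (u : TangentSpace 𝓘(ℝ, Fin (2 * k - 1 + 1) → E) p) :
    lagrangianForm L p u =
      (legendre L p).2 (mfderiv 𝓘(ℝ, Fin (2 * k - 1 + 1) → E) 𝓘(ℝ, Fin (k - 1 + 1) → E)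
        (rho E Q k) p u) := by
  have h := lagrangianForm_eq_zero L p
    ((show Fin (2 * k - 1 + 1) → E from u) - extendZero E (k - 1) (2 * k - 1) (trunc E (sub_one_le_two_mul_sub_one k) u)) (by
      intro i hi
      have hi' : (i : ℕ) < k - 1 + 1 := Nat.lt_succ_of_le hi
      show u i - (if h : (i : ℕ) < k - 1 + 1 then
        ContinuousLinearMap.proj (R := ℝ) (φ := fun _ => E) ⟨i, h⟩ else 0)
          (trunc E (sub_one_le_two_mul_sub_one k) u) = 0
      rw [dif_pos hi']
      exact sub_self _)
  erw [map_sub] at h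
  rw [mfderiv_proj]
  exact sub_eq_zero.1 h

/-! ### The unified formalism -/

variable (E Q) in
/-- The unified phase space `W = T^{2k-1} Q ×_{T^{k-1} Q} T^* (T^{k-1} Q)`, the total space of the
pull-back of the cotangent bundle of `T^{k-1} Q` by `T^{2k-1} Q → T^{k-1} Q`. -/
abbrev Unified (k : ℕ) : Type _ :=
  TotalSpace ((Fin (k - 1 + 1) → E) →L[ℝ] ℝ)
    ((rho E Q k : HigherTangent (2 * k - 1) E Q → HigherTangent (k - 1) E Q) *ᵖ
      fun q : HigherTangent (k - 1) E Q => TangentSpace 𝓘(ℝ, Fin (k - 1 + 1) → E) q →L[ℝ] ℝ)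

variable (E) in
/-- The model of `W`. -/
abbrev unifiedModel (k : ℕ) :=
  𝓘(ℝ, Fin (2 * k - 1 + 1) → E).prod 𝓘(ℝ, (Fin (k - 1 + 1) → E) →L[ℝ] ℝ)

/-- The projection `pr_1 : W → T^{2k-1} Q`. -/
def pr1 (w : Unified E Q k) : HigherTangent (2 * k - 1) E Q := w.1

/-- The projection `pr_2 : W → T^* (T^{k-1} Q)`. -/
def pr2 (w : Unified E Q k) : PhaseSpace E Q k := ⟨rho E Q k w.1, w.2⟩

/-- The presymplectic form `Ω = pr_2^* ω_{k-1}`. -/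
def unifiedTwoForm (w : Unified E Q k) (u v : TangentSpace (unifiedModel E k) w) : ℝ :=
  canonicalTwoForm 𝓘(ℝ, Fin (k - 1 + 1) → E) (HigherTangent (k - 1) E Q) (pr2 w)
    (mfderiv (unifiedModel E k) (phaseModel E k) pr2 w u)
    (mfderiv (unifiedModel E k) (phaseModel E k) pr2 w v)

/-- The coupling function `C (p, α) = ⟨α, j_k (p)⟩`. -/
def coupling [NeZero k] (w : Unified E Q k) : ℝ :=
  (pr2 w).2 (inj (show k - 1 + 1 ≤ 2 * k - 1 by have := NeZero.one_le (n := k); omega) (pr1 w))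

/-- The Hamiltonian function `H = C - L` on `W`. -/
def unifiedHamiltonian [NeZero k] (L : LagrangianFunction E Q k) (w : Unified E Q k) : ℝ :=
  coupling w -
    L (proj E Q (show k ≤ 2 * k - 1 by have := NeZero.one_le (n := k); omega) (pr1 w))

/-- The map `p ↦ (p, FL (p))` from `T^{2k-1} Q` to `W`. -/
def legendreGraph (L : LagrangianFunction E Q k) (p : HigherTangent (2 * k - 1) E Q) :
    Unified E Q k := ⟨p, (legendre L p).2⟩

/-- The submanifold `W_o = graph FL` of `W`. -/
def graphSet (L : LagrangianFunction E Q k) : Set (Unified E Q k) := {w | pr2 w = legendre L (pr1 w)}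

/-- `X` is a smooth vector field on `W` at support on `W_o` (the values of `X` outside `W_o` are
irrelevant), tangent to `W_o`, which is a solution to `[i(X) Ω - dH]|_{W_o} = 0`. -/
structure IsUnifiedSolution [NeZero k] (L : LagrangianFunction E Q k)
    (X : (w : Unified E Q k) → TangentSpace (unifiedModel E k) w) : Prop where
  smooth : ContMDiffOn (unifiedModel E k) (unifiedModel E k).tangent ∞
    (fun w => (⟨w, X w⟩ : TangentBundle (unifiedModel E k) (Unified E Q k))) (graphSet L)
  tangent : ∀ p : HigherTangent (2 * k - 1) E Q,
    X (legendreGraph L p) ∈ LinearMap.range (mfderiv 𝓘(ℝ, Fin (2 * k - 1 + 1) → E)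
      (unifiedModel E k) (legendreGraph L) p).toLinearMap
  dynamical : ∀ w ∈ graphSet L, ∀ v : TangentSpace (unifiedModel E k) w,
    unifiedTwoForm w (X w) v =
      (mfderiv (unifiedModel E k) 𝓘(ℝ, ℝ) (unifiedHamiltonian L) w :
        TangentSpace (unifiedModel E k) w →L[ℝ] ℝ) v

/-- The vector field `X_L` on `T^{2k-1} Q` determined by `X_L ∘ pr_1 = T pr_1 ∘ X` on `W_o`. -/
def lagrangianField (L : LagrangianFunction E Q k)
    (X : (w : Unified E Q k) → TangentSpace (unifiedModel E k) w)
    (p : HigherTangent (2 * k - 1) E Q) : TangentSpace 𝓘(ℝ, Fin (2 * k - 1 + 1) → E) p :=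
  mfderiv (unifiedModel E k) 𝓘(ℝ, Fin (2 * k - 1 + 1) → E) pr1 (legendreGraph L p)
    (X (legendreGraph L p))

/-- `X_h = FL_* X_L`: the vector field `X_h` satisfies `X_h ∘ FL = T FL ∘ X_L`. -/
def IsLegendrePushforward (L : LagrangianFunction E Q k)
    (XL : (p : HigherTangent (2 * k - 1) E Q) → TangentSpace 𝓘(ℝ, Fin (2 * k - 1 + 1) → E) p)
    (Xh : (α : PhaseSpace E Q k) → TangentSpace (phaseModel E k) α) : Prop :=
  ∀ p, Xh (legendre L p) =
    mfderiv 𝓘(ℝ, Fin (2 * k - 1 + 1) → E) (phaseModel E k) (legendre L) p (XL p)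

end Lagrangian

end HigherOrder

end

/-! The theorem is the chain rule. Where `σ' = X ∘ σ`, the curve `FL ∘ pr₁ ∘ σ` has derivative `T FL
(T pr₁ (X (σ t)))`. Since `σ t` lies on the graph of `FL`, it is the point of the graph over `pr₁ (σ
t)`, so this derivative equals `T FL (X_L (pr₁ (σ t)))`, which is `X_h` at `FL (pr₁ (σ t))`.

The chain rule needs `FL` to be differentiable, because `mfderiv` is zero at a point where the map
is not. Nearly all of the work is therefore `contMDiff_legendre`, the smoothness of `FL`. It is not
visible from the definitions: `J_r`, `d_T` and `FL` are given pointwise, each in the preferred chart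
at the point, and this chart may jump as the point moves. A form has to be read in one fixed natural
chart `e` (`localForm`), and the formulas for `d_{J_r} L`, `d_T` and pull-back must be shown to keep
their shape there. This is the invariance of the constructions under changes of natural coordinates
`prolong m f`, where `f` is a change of charts of `Q`.

The invariance is proved with curves, not with the Faà di Bruno formula: `prolong m f` sends the
derivatives of `σ` to those of `f ∘ σ`. Moving along the curve gives the compatibility with `d_T`
(`shift_prolong`). Varying the curve as `σ + s τ` gives the tangent map
(`fderiv_prolong_iteratedDeriv`). Replacing `τ` by `t ^ r τ` gives the compatibility with `J_r`
(`fderiv_prolong_verticalModel`). Finally `θ_L` vanishes on vectors vertical over `T^{k-1} Q`, so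
its restriction along the zero extension, which defines `FL`, also transforms correctly. -/

noncomputable section

namespace HigherOrder

open HigherTangent

/-! ### Prolonged maps on derivatives of curves: total derivative, tangent map, vertical
endomorphisms. -/

section Prolong

variable {E F : Type*} [NormedAddCommGroup E] [NormedSpace ℝ E] [NormedAddCommGroup F]
  [NormedSpace ℝ F]

/-- The action of `prolong` on the derivatives of a curve at an arbitrary time. -/
theorem prolong_iteratedDeriv {f : E → F} {σ : ℝ → E} {t : ℝ} (hf : ContDiffAt ℝ ∞ f (σ t))
    (hσ : ContDiffAt ℝ ∞ σ t) (m : ℕ) (i : Fin (m + 1)) :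
    prolong m f (fun j => iteratedDeriv j σ t) i = iteratedDeriv i (f ∘ σ) t := by
  rw [iteratedDeriv_vcomp_eq_sum_orderedFinpartition (n := ∞) hf hσ (by exact_mod_cast le_top)]
  simp [prolong]

theorem hasDerivAt_iteratedDeriv {σ : ℝ → F} {t : ℝ} (hσ : ContDiffAt ℝ ∞ σ t) (i : ℕ) :
    HasDerivAt (iteratedDeriv i σ) (iteratedDeriv (i + 1) σ t) t := by
  rw [iteratedDeriv_succ, hasDerivAt_deriv_iff]
  have h1 : DifferentiableAt ℝ (iteratedFDeriv ℝ i σ) t :=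
    (hσ.iteratedFDeriv_right (m := 1) (by exact_mod_cast le_top)).differentiableAt (by simp)
  rw [iteratedDeriv_eq_equiv_comp]
  exact (LinearIsometryEquiv.differentiable _).differentiableAt.comp t h1

/-- The derivatives of `f ∘ σ` of order at least one are the total derivatives of those of lower
order. -/
theorem shift_prolong {f : E → F} {U : Set E} (hU : IsOpen U) (hf : ContDiffOn ℝ ∞ f U) {m : ℕ}
    {y : Fin (m + 2) → E} (hy : y 0 ∈ U) :
    shift F m (prolong (m + 1) f y)
      = fderiv ℝ (prolong m f) (trunc E (Nat.le_succ m) y) (shift E m y) := by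
  have hσ := contDiff_polyCurve y
  have hfa : ∀ x ∈ U, ContDiffAt ℝ ∞ f x := fun x hx => hf.contDiffAt (hU.mem_nhds hx)
  have h0 : polyCurve y 0 ∈ U := by rwa [polyCurve_zero]
  have hy0 : (fun j : Fin (m + 2) => iteratedDeriv j (polyCurve y) 0) = y :=
    funext fun j => iteratedDeriv_polyCurve y j
  -- The moving `m`-jet of the polynomial curve with derivatives `y`; its velocity at `0` is the
  -- shift of `y`.
  let S : ℝ → Fin (m + 1) → E := fun t j => iteratedDeriv j (polyCurve y) t
  have hS0 : S 0 = trunc E (Nat.le_succ m) y :=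
    funext fun j => iteratedDeriv_polyCurve y (Fin.castLE (Nat.succ_le_succ (Nat.le_succ m)) j)
  have hS : HasDerivAt S (shift E m y) 0 := by
    rw [hasDerivAt_pi]
    intro j
    have := hasDerivAt_iteratedDeriv (t := 0) hσ.contDiffAt j
    rwa [show iteratedDeriv ((j : ℕ) + 1) (polyCurve y) 0 = y j.succ from
      iteratedDeriv_polyCurve y j.succ] at this
  have hP : DifferentiableAt ℝ (prolong m f) (S 0) :=
    (contDiffAt_prolong (hfa _ (by rw [hS0]; exact hy))).differentiableAt (by simp)
  have h1 : HasDerivAt (prolong m f ∘ S) (fderiv ℝ (prolong m f) (S 0) (shift E m y)) 0 :=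
    hP.hasFDerivAt.comp_hasDerivAt 0 hS
  -- Along `S` the map `prolong m f` gives the moving `m`-jet of `f ∘ polyCurve y`, whose velocity
  -- consists of the next derivatives. Comparison with the chain rule gives the identity.
  have hev : prolong m f ∘ S =ᶠ[𝓝 0] fun t j => iteratedDeriv (j : ℕ) (f ∘ polyCurve y) t := by
    filter_upwards [hσ.continuous.continuousAt.eventually (hU.mem_nhds h0)] with t ht
    exact funext fun j => prolong_iteratedDeriv (hfa _ ht) hσ.contDiffAt m j
  have h2 := h1.congr_of_eventuallyEq hev.symm
  rw [hS0] at h2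
  refine funext fun j => ?_
  rw [hasDerivAt_pi] at h2
  have h3 := prolong_iteratedDeriv (hfa _ h0) hσ.contDiffAt (m + 1) j.succ
  rw [hy0] at h3
  exact h3.trans ((hasDerivAt_iteratedDeriv ((hfa _ h0).comp 0 hσ.contDiffAt) j).unique (h2 j))

/-- Interchange of a derivative with iterated derivatives in another variable. -/
theorem hasDerivAt_iteratedDeriv_param {U : Set (ℝ × ℝ)} (hU : IsOpen U) (i : ℕ) :
    ∀ {g : ℝ × ℝ → F}, ContDiffOn ℝ ∞ g U → (0, 0) ∈ U →
    HasDerivAt (fun s => iteratedDeriv i (fun t => g (s, t)) 0)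
      (iteratedDeriv i (fun t => fderiv ℝ g (0, t) (1, 0)) 0) 0 := by
  have hsec : ∀ {g : ℝ × ℝ → F}, ContDiffOn ℝ ∞ g U → ∀ {s t : ℝ}, (s, t) ∈ U →
      HasDerivAt (fun t => g (s, t)) (fderiv ℝ g (s, t) (0, 1)) t := by
    intro g hg s t h
    have hd := ((hg.contDiffAt (hU.mem_nhds h)).differentiableAt (by simp)).hasFDerivAt
    exact hd.comp_hasDerivAt t ((hasDerivAt_const t s).prodMk (hasDerivAt_id t))
  have hD : ∀ {g : ℝ × ℝ → F}, ContDiffOn ℝ ∞ g U → ∀ v : ℝ × ℝ,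
      ContDiffOn ℝ ∞ (fun x => fderiv ℝ g x v) U := fun hg v =>
    (hg.fderiv_of_isOpen hU (m := ∞) (by simp)).clm_apply contDiffOn_const
  induction i with
  | zero =>
    intro g hg h0
    simp only [iteratedDeriv_zero]
    have hd := ((hg.contDiffAt (hU.mem_nhds h0)).differentiableAt (by simp)).hasFDerivAt
    exact HasFDerivAt.comp_hasDerivAt (f := fun s : ℝ => (s, (0 : ℝ))) (0 : ℝ) hd
      ((hasDerivAt_id (0 : ℝ)).prodMk (hasDerivAt_const (0 : ℝ) (0 : ℝ)))
  | succ i ih =>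
    intro g hg h0
    -- The induction hypothesis is applied to `∂g/∂t`, which is why `g` is quantified inside the
    -- induction.
    have h1 := ih (hD hg (0, 1)) h0
    have hmem : ∀ᶠ s in 𝓝 (0 : ℝ), (s, (0 : ℝ)) ∈ U :=
      (by fun_prop : ContinuousAt (fun s : ℝ => (s, (0 : ℝ))) 0).eventually (hU.mem_nhds h0)
    have hmem' : ∀ s, (s, (0 : ℝ)) ∈ U → ∀ᶠ t in 𝓝 (0 : ℝ), (s, t) ∈ U := fun s hs =>
      (by fun_prop : ContinuousAt (fun t : ℝ => (s, t)) 0).eventually (hU.mem_nhds hs)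
    have hev : (fun s => iteratedDeriv (i + 1) (fun t => g (s, t)) 0) =ᶠ[𝓝 0]
        fun s => iteratedDeriv i (fun t => fderiv ℝ g (s, t) (0, 1)) 0 := by
      filter_upwards [hmem] with s hs
      rw [iteratedDeriv_succ']
      refine Filter.EventuallyEq.iteratedDeriv_eq i ?_
      filter_upwards [hmem' s hs] with t ht
      exact (hsec hg ht).deriv
    refine (h1.congr_of_eventuallyEq hev).congr_deriv ?_
    rw [iteratedDeriv_succ']
    refine Filter.EventuallyEq.iteratedDeriv_eq i ?_
    filter_upwards [hmem' 0 h0] with t ht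
    rw [(hsec (hD hg (1, 0)) ht).deriv]
    have hc := hg.contDiffAt (hU.mem_nhds ht)
    have hd : DifferentiableAt ℝ (fderiv ℝ g) (0, t) :=
      (hc.fderiv_right (m := 1) (by norm_cast)).differentiableAt (by simp)
    -- What remains is the equality of the two mixed partial derivatives of `g`.
    have hsym := hc.isSymmSndFDerivAt
      (by rw [minSmoothness_of_isRCLikeNormedField]; exact WithTop.coe_le_coe.2 le_top) (1, 0) (0, 1)
    rw [fderiv_clm_apply hd (differentiableAt_const _),
      fderiv_clm_apply hd (differentiableAt_const _)]
    simpa using hsym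

/-- The derivative of `prolong m f`, in terms of curves. -/
theorem fderiv_prolong_iteratedDeriv {f : E → F} {U : Set E} (hU : IsOpen U)
    (hf : ContDiffOn ℝ ∞ f U) {σ τ : ℝ → E} (hσ : ContDiff ℝ ∞ σ) (hτ : ContDiff ℝ ∞ τ)
    (h0 : σ 0 ∈ U) (m : ℕ) (i : Fin (m + 1)) :
    fderiv ℝ (prolong m f) (fun j => iteratedDeriv j σ 0) (fun j => iteratedDeriv j τ 0) i
      = iteratedDeriv i (fun t => fderiv ℝ f (σ t) (τ t)) 0 := by
  have hfa : ∀ x ∈ U, ContDiffAt ℝ ∞ f x := fun x hx => hf.contDiffAt (hU.mem_nhds hx)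
  -- The variation of `σ` in the direction `τ`. The `s`-derivative at `0` of the `i`-th
  -- `t`-derivative of `f ∘ a` is computed in two ways: by the chain rule for `prolong m f`, and by
  -- interchanging the derivatives.
  let a : ℝ × ℝ → E := fun z => σ z.2 + z.1 • τ z.2
  have ha : ContDiff ℝ ∞ a :=
    (hσ.comp contDiff_snd).add (contDiff_fst.smul (hτ.comp contDiff_snd))
  let V : Set (ℝ × ℝ) := a ⁻¹' U
  have hV : IsOpen V := hU.preimage ha.continuous
  have h0V : ((0 : ℝ), (0 : ℝ)) ∈ V := by simpa [V, a] using h0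
  have hg : ContDiffOn ℝ ∞ (f ∘ a) V := hf.comp ha.contDiffOn fun _ h => h
  have h1 := hasDerivAt_iteratedDeriv_param hV i hg h0V
  set y : Fin (m + 1) → E := fun j => iteratedDeriv j σ 0
  set w : Fin (m + 1) → E := fun j => iteratedDeriv j τ 0
  have hP : HasFDerivAt (prolong m f) (fderiv ℝ (prolong m f) y) (y + (0 : ℝ) • w) := by
    rw [zero_smul, add_zero]
    exact ((contDiffAt_prolong (hfa _ (by simpa [y] using h0))).differentiableAt
      (by simp)).hasFDerivAt
  have hl : HasDerivAt (fun s : ℝ => y + s • w) w 0 := by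
    simpa using ((hasDerivAt_id (0 : ℝ)).smul_const w).const_add y
  have h2 := hP.comp_hasDerivAt 0 hl
  rw [hasDerivAt_pi] at h2
  -- Taking derivatives is linear, so the `m`-jet of `σ + s τ` is the point `y + s • w` of a
  -- straight line.
  have hev : (fun s => iteratedDeriv (i : ℕ) (fun t => (f ∘ a) (s, t)) 0) =ᶠ[𝓝 0]
      fun s => (prolong m f ∘ fun s : ℝ => y + s • w) s i := by
    filter_upwards [(by fun_prop : ContinuousAt (fun s : ℝ => (s, (0 : ℝ))) 0).eventually
      (hV.mem_nhds h0V)] with s hs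
    have hs' : ContDiff ℝ ∞ (fun t => a (s, t)) := hσ.add (contDiff_const.smul hτ)
    have := prolong_iteratedDeriv (t := 0) (σ := fun t => a (s, t)) (hfa _ hs) hs'.contDiffAt m i
    rw [show (fun t => (f ∘ a) (s, t)) = f ∘ fun t => a (s, t) from rfl, ← this]
    simp only [Function.comp_apply]
    congr 1
    refine funext fun j => ?_
    show iteratedDeriv j (fun t => σ t + s • τ t) 0 = iteratedDeriv j σ 0 + s • iteratedDeriv j τ 0
    have hle : ((j : ℕ) : WithTop ℕ∞) ≤ ∞ := by exact_mod_cast le_top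
    have hsτ : ContDiff ℝ ∞ (fun t => s • τ t) := contDiff_const.smul hτ
    rw [iteratedDeriv_fun_add (hσ.of_le hle).contDiffAt (hsτ.of_le hle).contDiffAt]
    congr 1
    exact iteratedDeriv_fun_const_smul (hτ.of_le hle).contDiffAt s
  refine ((h2 i).congr_of_eventuallyEq hev).unique h1 |>.trans ?_
  refine Filter.EventuallyEq.iteratedDeriv_eq _ ?_
  filter_upwards [(by fun_prop : ContinuousAt (fun t : ℝ => ((0 : ℝ), t)) 0).eventually
    (hV.mem_nhds h0V)] with t ht
  have ht' : a (0, t) = σ t := by simp [a]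
  have hd := ((hg.contDiffAt (hV.mem_nhds ht)).differentiableAt (by simp)).hasFDerivAt
  have e1 : HasDerivAt (fun s : ℝ => (f ∘ a) (s, t)) (fderiv ℝ (f ∘ a) (0, t) (1, 0)) 0 :=
    HasFDerivAt.comp_hasDerivAt (f := fun s : ℝ => (s, t)) (0 : ℝ) hd
      ((hasDerivAt_id (0 : ℝ)).prodMk (hasDerivAt_const (0 : ℝ) t))
  have e2 : HasDerivAt (fun s : ℝ => a (s, t)) (τ t) 0 := by
    simpa [a] using ((hasDerivAt_id (0 : ℝ)).smul_const (τ t)).const_add (σ t)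
  have e3 : HasFDerivAt f (fderiv ℝ f (σ t)) (a (0, t)) := by
    rw [ht']
    exact ((hfa _ (ht' ▸ ht)).differentiableAt (by simp)).hasFDerivAt
  exact e1.unique (e3.comp_hasDerivAt 0 e2)

/-- Derivatives at `0` of `t ↦ t • σ t`. -/
theorem iteratedDeriv_succ_id_smul_zero {σ : ℝ → F} (i : ℕ) (hσ : ContDiffAt ℝ ∞ σ 0) :
    iteratedDeriv (i + 1) (fun t => t • σ t) 0 = ((i + 1 : ℕ) : ℝ) • iteratedDeriv i σ 0 := by
  induction i generalizing σ with
  | zero =>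
    have h := (hasDerivAt_id (0 : ℝ)).fun_smul (hσ.differentiableAt (by simp)).hasDerivAt
    simpa using h.deriv
  | succ i ih =>
    have hσ' : ContDiffAt ℝ ∞ (deriv σ) 0 := (hσ.fderiv_right (by simp)).clm_apply contDiffAt_const
    -- Each differentiation releases one copy of `σ`; the term that keeps the factor `t` is handled
    -- by the induction hypothesis for `deriv σ`.
    have hev : deriv (fun t => t • σ t) =ᶠ[𝓝 0] fun t => t • deriv σ t + σ t := by
      filter_upwards [(hσ.of_le (m := 1) (by exact_mod_cast le_top)).eventually (by simp)]
        with t ht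
      have h := (hasDerivAt_id t).fun_smul (ht.differentiableAt (by simp)).hasDerivAt
      simpa using h.deriv
    have hle : ((i + 1 : ℕ) : WithTop ℕ∞) ≤ ∞ := by exact_mod_cast le_top
    have h1 : ContDiffAt ℝ ∞ (fun t : ℝ => t • deriv σ t) 0 := contDiffAt_id.smul hσ'
    rw [iteratedDeriv_succ', hev.iteratedDeriv_eq,
      iteratedDeriv_fun_add (h1.of_le hle) (hσ.of_le hle), ih hσ', ← iteratedDeriv_succ']
    push_cast
    module

/-- Derivatives at `0` of `t ↦ t ^ r • σ t`. -/
theorem iteratedDeriv_pow_smul_zero {σ : ℝ → F} (r : ℕ) (i : ℕ) (hσ : ContDiffAt ℝ ∞ σ 0) :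
    iteratedDeriv i (fun t => t ^ r • σ t) 0
      = if r ≤ i then ((i.descFactorial r : ℕ) : ℝ) • iteratedDeriv (i - r) σ 0 else 0 := by
  induction r generalizing i with
  | zero => simp
  | succ r ih =>
    simp only [pow_succ', mul_smul]
    have hr : ContDiffAt ℝ ∞ (fun t : ℝ => t ^ r • σ t) 0 := (contDiffAt_id.pow r).smul hσ
    cases i with
    | zero => simp
    | succ i =>
      rw [iteratedDeriv_succ_id_smul_zero i hr, ih i]
      by_cases h : r ≤ i
      · rw [if_pos h, if_pos (Nat.succ_le_succ h), smul_smul, Nat.succ_descFactorial_succ,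
          Nat.add_sub_add_right]
        push_cast
        rfl
      · simp [h]

variable (E) in
/-- The `r`-th vertical endomorphism in natural coordinates. -/
def verticalModel (m r : ℕ) : (Fin (m + 1) → E) →L[ℝ] (Fin (m + 1) → E) :=
  ContinuousLinearMap.pi (R := ℝ) (M := Fin (m + 1) → E) (φ := fun _ : Fin (m + 1) => E) fun i =>
    if r ≤ (i : ℕ) then
      (((i : ℕ).descFactorial r : ℕ) : ℝ) • ContinuousLinearMap.proj (R := ℝ) (φ := fun _ => E)
        (⟨(i : ℕ) - r, (Nat.sub_le _ _).trans_lt i.2⟩ : Fin (m + 1))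
    else 0

theorem verticalModel_apply (m r : ℕ) (v : Fin (m + 1) → E) (i : Fin (m + 1)) :
    verticalModel E m r v i = if r ≤ (i : ℕ) then (((i : ℕ).descFactorial r : ℕ) : ℝ) •
      v ⟨(i : ℕ) - r, (Nat.sub_le _ _).trans_lt i.2⟩ else 0 := by
  simp only [verticalModel, ContinuousLinearMap.coe_pi']
  split_ifs <;> rfl

/-- The vertical endomorphisms are invariant under changes of natural coordinates. -/
theorem fderiv_prolong_verticalModel {f : E → F} {U : Set E} (hU : IsOpen U)
    (hf : ContDiffOn ℝ ∞ f U) {m : ℕ} {y : Fin (m + 1) → E} (hy : y 0 ∈ U) (r : ℕ)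
    (v : Fin (m + 1) → E) :
    fderiv ℝ (prolong m f) y (verticalModel E m r v)
      = verticalModel F m r (fderiv ℝ (prolong m f) y v) := by
  have hσ := contDiff_polyCurve y
  have hτ := contDiff_polyCurve v
  have hy0 : (fun j : Fin (m + 1) => iteratedDeriv j (polyCurve y) 0) = y :=
    funext fun j => iteratedDeriv_polyCurve y j
  have hv0 : (fun j : Fin (m + 1) => iteratedDeriv j (polyCurve v) 0) = v :=
    funext fun j => iteratedDeriv_polyCurve v j
  have h0 : polyCurve y 0 ∈ U := by rwa [polyCurve_zero]
  -- If `v` is the jet of `τ`, then `J_r v` is the jet of `t ^ r τ`: the descending factorials come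
  -- from Leibniz's rule at `0`.
  have hτr : ContDiff ℝ ∞ (fun t : ℝ => t ^ r • polyCurve v t) := by fun_prop
  have hw : (fun j : Fin (m + 1) => iteratedDeriv j (fun t : ℝ => t ^ r • polyCurve v t) 0)
      = verticalModel E m r v := by
    refine funext fun j => ?_
    rw [iteratedDeriv_pow_smul_zero r j hτ.contDiffAt, verticalModel_apply]
    congr 2
    exact congrFun hv0 (⟨(j : ℕ) - r, (Nat.sub_le _ _).trans_lt j.2⟩ : Fin (m + 1))
  have key := fun w hw => fderiv_prolong_iteratedDeriv hU hf hσ (τ := w) hw h0 m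
  have hG : ContDiffAt ℝ ∞ (fun t => fderiv ℝ f (polyCurve y t) (polyCurve v t)) 0 := by
    have h1 : ContDiffAt ℝ ∞ (fderiv ℝ f) (polyCurve y 0) :=
      (hf.contDiffAt (hU.mem_nhds h0)).fderiv_right (by simp)
    exact (h1.comp 0 hσ.contDiffAt).clm_apply hτ.contDiffAt
  refine funext fun i => ?_
  have e1 := key _ hτr i
  -- The reason for the invariance: the scalar `t ^ r` commutes with the linear map `Df (σ t)`.
  simp only [map_smul] at e1
  rw [hy0, hw, iteratedDeriv_pow_smul_zero r i hG] at e1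
  rw [e1, verticalModel_apply]
  congr 2
  have e2 := key _ hτ ⟨(i : ℕ) - r, (Nat.sub_le _ _).trans_lt i.2⟩
  rw [hy0, hv0] at e2
  exact e2.symm

/-- The first `r + 1` components of `prolong m f` involve only the first `r + 1` entries, so
prolongation commutes with truncation by definition; this is the derivative of that equality. -/
theorem trunc_fderiv_prolong {m r : ℕ} (h : r ≤ m) {f : E → F} {y : Fin (m + 1) → E}
    (hf : ContDiffAt ℝ ∞ f (y 0)) (v : Fin (m + 1) → E) :
    trunc F h (fderiv ℝ (prolong m f) y v)
      = fderiv ℝ (prolong r f) (trunc E h y) (trunc E h v) := by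
  have h1 : HasFDerivAt (prolong m f) (fderiv ℝ (prolong m f) y) y :=
    ((contDiffAt_prolong hf).differentiableAt (by simp)).hasFDerivAt
  have hf' : ContDiffAt ℝ ∞ f (trunc E h y 0) := hf
  have h2 : HasFDerivAt (prolong r f) _ (trunc E h y) :=
    ((contDiffAt_prolong hf').differentiableAt (by simp)).hasFDerivAt
  exact DFunLike.congr_fun (((trunc F h).hasFDerivAt.comp y h1).unique
    (h2.comp y (trunc E h).hasFDerivAt)) v

/-- Obtained by differentiating `shift_prolong` in `y`, which enters both as base point and as
vector. The resulting second-derivative term is the one that appears when `d_T` is moved to another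
chart. -/
theorem shift_fderiv_prolong {f : E → F} {U : Set E} (hU : IsOpen U) (hf : ContDiffOn ℝ ∞ f U)
    {m : ℕ} {y : Fin (m + 2) → E} (hy : y 0 ∈ U) (v : Fin (m + 2) → E) :
    shift F m (fderiv ℝ (prolong (m + 1) f) y v) =
      fderiv ℝ (fderiv ℝ (prolong m f)) (trunc E (Nat.le_succ m) y)
          (trunc E (Nat.le_succ m) v) (shift E m y)
        + fderiv ℝ (prolong m f) (trunc E (Nat.le_succ m) y) (shift E m v) := by
  have hfy : ContDiffAt ℝ ∞ f (y 0) := hf.contDiffAt (hU.mem_nhds hy)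
  have hfy' : ContDiffAt ℝ ∞ f (trunc E (Nat.le_succ m) y 0) := hfy
  have h1 : HasFDerivAt (prolong (m + 1) f) (fderiv ℝ (prolong (m + 1) f) y) y :=
    ((contDiffAt_prolong hfy).differentiableAt (by simp)).hasFDerivAt
  have h2 : HasFDerivAt (fderiv ℝ (prolong m f)) _ (trunc E (Nat.le_succ m) y) :=
    (((contDiffAt_prolong hfy').fderiv_right (m := 1) (by norm_cast)).differentiableAt
      (by simp)).hasFDerivAt
  have h3 := (h2.comp y (trunc E (Nat.le_succ m)).hasFDerivAt).clm_apply (shift E m).hasFDerivAt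
  have hev : shift F m ∘ prolong (m + 1) f =ᶠ[𝓝 y]
      fun z => (fderiv ℝ (prolong m f) ∘ trunc E (Nat.le_succ m)) z (shift E m z) := by
    filter_upwards [(hU.preimage (continuous_apply 0)).mem_nhds hy] with z hz
    exact shift_prolong hU hf hz
  have h4 := DFunLike.congr_fun (((shift F m).hasFDerivAt.comp y h1).unique
    (h3.congr_of_eventuallyEq hev)) v
  exact h4.trans (add_comm _ _)

end Prolong

/-! ### Domains of changes of charts. -/

section Overlap

variable {E Q : Type*} [NormedAddCommGroup E] [TopologicalSpace Q]

/-- The part of the target of `e` where the change of charts from `e` to `e'` is defined. -/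
def overlap (e e' : OpenPartialHomeomorph Q E) : Set E := e.target ∩ e.symm ⁻¹' e'.source

theorem isOpen_overlap (e e' : OpenPartialHomeomorph Q E) : IsOpen (overlap e e') :=
  e.isOpen_inter_preimage_symm e'.open_source

theorem overlap_self (e : OpenPartialHomeomorph Q E) : overlap e e = e.target := by
  refine inter_eq_left.2 fun y hy => e.map_target hy

theorem isOpen_preimage_apply_zero (m : ℕ) {U : Set E} (hU : IsOpen U) :
    IsOpen {y : Fin (m + 1) → E | y 0 ∈ U} :=
  hU.preimage (continuous_apply 0)

end Overlap

/-! ### Natural coordinates on `T^m Q` and their changes. -/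

section NaturalCharts

variable {E : Type*} [NormedAddCommGroup E] [NormedSpace ℝ E]
  {Q : Type*} [TopologicalSpace Q] [ChartedSpace E Q]

variable [IsManifold 𝓘(ℝ, E) ∞ Q] {m r : ℕ} {e e' e'' : OpenPartialHomeomorph Q E}

theorem contDiffOn_transition (he : e ∈ atlas E Q) (he' : e' ∈ atlas E Q) :
    ContDiffOn ℝ ∞ (e' ∘ e.symm) (overlap e e') := fun _ hy =>
  (contDiffAt_transition he he' hy.1 hy.2).contDiffWithinAt

theorem contDiffAt_prolong_transition (he : e ∈ atlas E Q) (he' : e' ∈ atlas E Q)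
    {y : Fin (m + 1) → E} (hy : y 0 ∈ overlap e e') :
    ContDiffAt ℝ ∞ (prolong m (e' ∘ e.symm)) y :=
  contDiffAt_prolong (contDiffAt_transition he he' hy.1 hy.2)

theorem coord_apply_zero (he : e ∈ atlas E Q) {p : HigherTangent m E Q} (hp : base p ∈ e.source) :
    coord e p 0 = e (base p) := by
  obtain ⟨σ, rfl⟩ := exists_jet p
  rw [coord_jet he hp]
  simp [curveCoord]

theorem base_jetChart_symm_mem (he : e ∈ atlas E Q) {y : Fin (m + 1) → E}
    (hy : y 0 ∈ e.target) : base ((jetChart m e he).symm y) ∈ e.source :=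
  (jetChart m e he).map_target hy

theorem coord_jetChart_symm (he : e ∈ atlas E Q) (he' : e' ∈ atlas E Q) {y : Fin (m + 1) → E}
    (hy : y 0 ∈ overlap e e') :
    coord e' ((jetChart m e he).symm y) = prolong m (e' ∘ e.symm) y :=
  jetChart_trans_apply he he' (by rw [jetChart_trans_source]; exact hy)

theorem coord_jetChart_symm_self (he : e ∈ atlas E Q) {y : Fin (m + 1) → E}
    (hy : y 0 ∈ e.target) : coord e ((jetChart m e he).symm y) = y :=
  (jetChart m e he).right_inv hy

theorem jetChart_symm_coord (he : e ∈ atlas E Q) {p : HigherTangent m E Q}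
    (hp : base p ∈ e.source) : (jetChart m e he).symm (coord e p) = p :=
  (jetChart m e he).left_inv hp

theorem base_mem_of_overlap (he : e ∈ atlas E Q) {y : Fin (m + 1) → E}
    (hy : y 0 ∈ overlap e e') : base ((jetChart m e he).symm y) ∈ e'.source := by
  rw [base_jetChart_symm he hy.1]
  exact hy.2

theorem jetChart_symm_prolong (he : e ∈ atlas E Q) (he' : e' ∈ atlas E Q) {y : Fin (m + 1) → E}
    (hy : y 0 ∈ overlap e e') :
    (jetChart m e' he').symm (prolong m (e' ∘ e.symm) y) = (jetChart m e he).symm y := by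
  rw [← coord_jetChart_symm he he' hy, jetChart_symm_coord he' (base_mem_of_overlap he hy)]

theorem prolong_transition_zero (he : e ∈ atlas E Q) (he' : e' ∈ atlas E Q) {y : Fin (m + 1) → E}
    (hy : y 0 ∈ overlap e e') : prolong m (e' ∘ e.symm) y 0 = e' (e.symm (y 0)) := by
  rw [← coord_jetChart_symm he he' hy, coord_apply_zero he' (base_mem_of_overlap he hy),
    base_jetChart_symm he hy.1]

theorem prolong_transition_zero_mem (he : e ∈ atlas E Q) (he' : e' ∈ atlas E Q)
    {y : Fin (m + 1) → E} (hy : y 0 ∈ overlap e e') (h : y 0 ∈ overlap e e'') :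
    prolong m (e' ∘ e.symm) y 0 ∈ overlap e' e'' := by
  rw [prolong_transition_zero he he' hy]
  refine ⟨e'.map_source hy.2, ?_⟩
  rw [mem_preimage, e'.left_inv hy.2]
  exact h.2

/-- Both sides are the coordinates in `e''` of one and the same jet, so the cocycle identity needs
no composition formula for `prolong`. -/
theorem prolong_transition_comp (he : e ∈ atlas E Q) (he' : e' ∈ atlas E Q)
    (he'' : e'' ∈ atlas E Q) {y : Fin (m + 1) → E} (hy : y 0 ∈ overlap e e')
    (h : y 0 ∈ overlap e e'') :
    prolong m (e'' ∘ e'.symm) (prolong m (e' ∘ e.symm) y) = prolong m (e'' ∘ e.symm) y := by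
  rw [← coord_jetChart_symm he' he'' (prolong_transition_zero_mem he he' hy h),
    jetChart_symm_prolong he he' hy, coord_jetChart_symm he he'' h]

theorem fderiv_prolong_transition_comp (he : e ∈ atlas E Q) (he' : e' ∈ atlas E Q)
    (he'' : e'' ∈ atlas E Q) {y : Fin (m + 1) → E} (hy : y 0 ∈ overlap e e')
    (h : y 0 ∈ overlap e e'') :
    fderiv ℝ (prolong m (e'' ∘ e.symm)) y =
      (fderiv ℝ (prolong m (e'' ∘ e'.symm)) (prolong m (e' ∘ e.symm) y)).comp
        (fderiv ℝ (prolong m (e' ∘ e.symm)) y) := by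
  rw [← fderiv_comp y ((contDiffAt_prolong_transition he' he''
    (prolong_transition_zero_mem he he' hy h)).differentiableAt (by simp))
    ((contDiffAt_prolong_transition he he' hy).differentiableAt (by simp))]
  refine Filter.EventuallyEq.fderiv_eq ?_
  filter_upwards [(isOpen_preimage_apply_zero m (isOpen_overlap e e')).mem_nhds hy,
    (isOpen_preimage_apply_zero m (isOpen_overlap e e'')).mem_nhds h] with z hz hz'
  exact (prolong_transition_comp he he' he'' hz hz').symm

theorem fderiv_prolong_transition_self (he : e ∈ atlas E Q) {y : Fin (m + 1) → E}
    (hy : y 0 ∈ e.target) :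
    fderiv ℝ (prolong m (e ∘ e.symm)) y = ContinuousLinearMap.id ℝ _ := by
  have : prolong m (e ∘ e.symm) =ᶠ[𝓝 y] id := by
    filter_upwards [(isOpen_preimage_apply_zero m e.open_target).mem_nhds hy] with z hz
    have hz' : z 0 ∈ e.target := hz
    rw [← coord_jetChart_symm he he (overlap_self e ▸ hz'), coord_jetChart_symm_self he hz', id]
  rw [this.fderiv_eq, fderiv_id]

/-- The tangent map of the inverse of a preferred chart of `T^m Q`. -/
theorem mfderiv_extChartAt_symm_eq (p : HigherTangent m E Q) {y : Fin (m + 1) → E}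
    (hy : y 0 ∈ (chartAt E (base p)).target) :
    mfderiv 𝓘(ℝ, Fin (m + 1) → E) 𝓘(ℝ, Fin (m + 1) → E)
      (extChartAt 𝓘(ℝ, Fin (m + 1) → E) p).symm y
      = fderiv ℝ (prolong m (chartAt E (base ((jetChart m (chartAt E (base p))
          (chart_mem_atlas E _)).symm y)) ∘ (chartAt E (base p)).symm)) y := by
  have hy' : y ∈ (extChartAt 𝓘(ℝ, Fin (m + 1) → E) p).target := by
    simpa using (show y ∈ (chartAt (Fin (m + 1) → E) p).target from hy)
  have hs : MDifferentiableAt 𝓘(ℝ, Fin (m + 1) → E) 𝓘(ℝ, Fin (m + 1) → E)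
      (extChartAt 𝓘(ℝ, Fin (m + 1) → E) p).symm y :=
    ((contMDiffOn_extChartAt_symm p).contMDiffAt
      (by exact (isOpen_extChartAt_target p).mem_nhds hy')).mdifferentiableAt
      (n := ∞) (by simp)
  rw [hs.mfderiv]
  simp only [modelWithCornersSelf_coe, range_id, fderivWithin_univ]
  -- The derivative is read in the preferred chart at the image of `y`. With that chart held fixed,
  -- the map is a prolonged change of charts near `y`.
  refine Filter.EventuallyEq.fderiv_eq ?_
  have he := chart_mem_atlas E (base p)
  have ho : y 0 ∈ overlap (chartAt E (base p))
      (chartAt E (base ((jetChart m (chartAt E (base p)) he).symm y))) := by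
    refine ⟨hy, ?_⟩
    rw [mem_preimage, ← base_jetChart_symm he hy]
    exact mem_chart_source E _
  filter_upwards [(isOpen_preimage_apply_zero m (isOpen_overlap _ _)).mem_nhds ho] with z hz
  exact coord_jetChart_symm he (chart_mem_atlas E _) hz

theorem mem_overlap_chartAt (he : e ∈ atlas E Q) {y : Fin (m + 1) → E} (hy : y 0 ∈ e.target) :
    y 0 ∈ overlap e (chartAt E (base ((jetChart m e he).symm y))) := by
  refine ⟨hy, ?_⟩
  rw [mem_preimage, ← base_jetChart_symm he hy]
  exact mem_chart_source E _

/-! ### One-forms read in a fixed natural chart, and their smoothness. -/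

/-- The components of a form at `p` in the preferred natural coordinates at `p`. -/
def formVal (η : JetForm E Q m) (p : HigherTangent m E Q) : (Fin (m + 1) → E) →L[ℝ] ℝ := η p

/-- The components of a form at `p` in the natural coordinates defined by the chart `e`, `y` being
the coordinates of `p`. -/
def formAt (η : JetForm E Q m) (e : OpenPartialHomeomorph Q E) (p : HigherTangent m E Q)
    (y : Fin (m + 1) → E) : (Fin (m + 1) → E) →L[ℝ] ℝ :=
  (formVal η p).comp (fderiv ℝ (prolong m (chartAt E (base p) ∘ e.symm)) y)

/-- The expression of a form in the natural coordinates defined by the chart `e`. -/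
def localForm (η : JetForm E Q m) (e : OpenPartialHomeomorph Q E) (he : e ∈ atlas E Q)
    (y : Fin (m + 1) → E) : (Fin (m + 1) → E) →L[ℝ] ℝ :=
  formAt η e ((jetChart m e he).symm y) y

theorem inChart_eq_localForm (η : JetForm E Q m) (p : HigherTangent m E Q) {y : Fin (m + 1) → E}
    (hy : y 0 ∈ (chartAt E (base p)).target) :
    η.inChart p y = localForm η (chartAt E (base p)) (chart_mem_atlas E _) y := by
  unfold OneForm.inChart
  rw [mfderiv_extChartAt_symm_eq p hy]
  rfl

/-- Change of natural coordinates in a form. -/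
theorem localForm_change (η : JetForm E Q m) (he : e ∈ atlas E Q) (he' : e' ∈ atlas E Q)
    {y : Fin (m + 1) → E} (hy : y 0 ∈ overlap e e') :
    localForm η e he y = (localForm η e' he' (prolong m (e' ∘ e.symm) y)).comp
      (fderiv ℝ (prolong m (e' ∘ e.symm)) y) := by
  unfold localForm
  rw [jetChart_symm_prolong he he' hy]
  unfold formAt
  rw [fderiv_prolong_transition_comp he he' (chart_mem_atlas E _) hy
    (mem_overlap_chartAt he hy.1)]
  rfl

theorem formAt_self (η : JetForm E Q m) (p : HigherTangent m E Q) :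
    formAt η (chartAt E (base p)) p (coord (chartAt E (base p)) p) = formVal η p := by
  have h : coord (chartAt E (base p)) p 0 ∈ (chartAt E (base p)).target :=
    (jetChart m (chartAt E (base p)) (chart_mem_atlas E _)).map_source
      (mem_chart_source E (base p))
  unfold formAt
  rw [fderiv_prolong_transition_self (chart_mem_atlas E _) h]
  rfl

/-- A form is smooth if its expressions in natural coordinates are smooth. -/
def IsSmoothForm (η : JetForm E Q m) : Prop :=
  ∀ (e : OpenPartialHomeomorph Q E) (he : e ∈ atlas E Q),
    ContDiffOn ℝ ∞ (localForm η e he) {y | y 0 ∈ e.target}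

theorem IsSmoothForm.contDiffAt {η : JetForm E Q m} (h : IsSmoothForm η) (he : e ∈ atlas E Q)
    {y : Fin (m + 1) → E} (hy : y 0 ∈ e.target) : ContDiffAt ℝ ∞ (localForm η e he) y :=
  (h e he).contDiffAt ((isOpen_preimage_apply_zero m e.open_target).mem_nhds hy)

theorem formVal_tulczyjew (η : JetForm E Q m) (p : HigherTangent (m + 1) E Q) :
    formVal (tulczyjew η) p =
      (fderiv ℝ (localForm η (chartAt E (base p)) (chart_mem_atlas E _))
        (trunc E (Nat.le_succ m) (coord (chartAt E (base p)) p))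
        (shift E m (coord (chartAt E (base p)) p))).comp (trunc E (Nat.le_succ m))
      + (localForm η (chartAt E (base p)) (chart_mem_atlas E _)
        (trunc E (Nat.le_succ m) (coord (chartAt E (base p)) p))).comp (shift E m) := by
  -- With a curve as representative, the jet and its projection have the same base point by
  -- definition, hence literally the same preferred chart of `Q`.
  obtain ⟨σ, rfl⟩ := exists_jet p
  set c := chartAt E (base (jet (m + 1) σ))
  have hcm : c ∈ atlas E Q := chart_mem_atlas E _
  have hσ : σ.1 0 ∈ c.source := mem_chart_source E (σ.1 0)
  have hT : trunc E (Nat.le_succ m) (coord c (jet (m + 1) σ)) = coord c (jet m σ) :=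
    (coord_projFun (p := jet (m + 1) σ) (Nat.le_succ m) hcm hσ).symm
  have h0 : coord c (jet m σ) 0 ∈ c.target := (jetChart m c hcm).map_source hσ
  have h1 : localForm η c hcm (coord c (jet m σ)) = formVal η (jet m σ) := by
    unfold localForm
    rw [jetChart_symm_coord (p := jet m σ) hcm hσ]
    exact formAt_self η (jet m σ)
  have h2 : η.inChart (jet m σ) =ᶠ[𝓝 (coord c (jet m σ))] localForm η c hcm := by
    filter_upwards [(isOpen_preimage_apply_zero m c.open_target).mem_nhds h0] with z hz
    exact inChart_eq_localForm η (jet m σ) hz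
  rw [hT, h1, ← h2.fderiv_eq]
  rfl

/-- The coordinate expression of Tulczyjew's derivation. -/
theorem localForm_tulczyjew {η : JetForm E Q m} (hη : IsSmoothForm η) (he : e ∈ atlas E Q)
    {y : Fin (m + 2) → E} (hy : y 0 ∈ e.target) :
    localForm (tulczyjew η) e he y =
      (fderiv ℝ (localForm η e he) (trunc E (Nat.le_succ m) y) (shift E m y)).comp
        (trunc E (Nat.le_succ m))
      + (localForm η e he (trunc E (Nat.le_succ m) y)).comp (shift E m) := by
  set p := (jetChart (m + 1) e he).symm y
  -- In the preferred chart `c` at `p` the formula is the definition of `d_T`; it remains to carry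
  -- it from `c` to `e`.
  set c := chartAt E (base p)
  have hcm : c ∈ atlas E Q := chart_mem_atlas E _
  have ho : y 0 ∈ overlap e c := mem_overlap_chartAt he hy
  set f := c ∘ e.symm
  set T := trunc E (Nat.le_succ m)
  have hTy : T y 0 ∈ overlap e c := ho
  set y' := prolong (m + 1) f y with hy'
  have hcp : coord c p = y' := coord_jetChart_symm he hcm ho
  have hy'0 : y' 0 ∈ c.target := (prolong_transition_zero_mem he hcm ho ho).1
  have hTy'0 : T y' 0 ∈ c.target := hy'0
  have hq : formVal (tulczyjew η) p =
      (fderiv ℝ (localForm η c hcm) (T y') (shift E m y')).comp T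
        + (localForm η c hcm (T y')).comp (shift E m) := by
    rw [← hcp]
    exact formVal_tulczyjew η p
  have hψ := contDiffAt_prolong_transition (m := m) he hcm hTy
  have hTy' : T y' = prolong m f (T y) := rfl
  have hsh : shift E m y' = fderiv ℝ (prolong m f) (T y) (shift E m y) :=
    shift_prolong (isOpen_overlap e c) (contDiffOn_transition he hcm) ho
  have hη' : DifferentiableAt ℝ (localForm η c hcm) (prolong m f (T y)) :=
    (hη.contDiffAt hcm hTy'0).differentiableAt (by simp)
  have hψ1 : DifferentiableAt ℝ (prolong m f) (T y) := hψ.differentiableAt (by simp)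
  have hψ2 : DifferentiableAt ℝ (fderiv ℝ (prolong m f)) (T y) :=
    (hψ.fderiv_right (m := 1) (by norm_cast)).differentiableAt (by simp)
  have hloc : localForm η e he =ᶠ[𝓝 (T y)] fun z =>
      (localForm η c hcm (prolong m f z)).comp (fderiv ℝ (prolong m f) z) := by
    filter_upwards [(isOpen_preimage_apply_zero m (isOpen_overlap e c)).mem_nhds hTy] with z hz
    exact localForm_change η he hcm hz
  have hd1 : HasFDerivAt (localForm η c hcm ∘ prolong m f) _ (T y) :=
    hη'.hasFDerivAt.comp (T y) hψ1.hasFDerivAt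
  have hd2 := (hd1.clm_comp hψ2.hasFDerivAt).congr_of_eventuallyEq hloc
  rw [hd2.fderiv, localForm_change η he hcm hTy]
  have hsT : ∀ v, T (fderiv ℝ (prolong (m + 1) f) y v) = fderiv ℝ (prolong m f) (T y) (T v) :=
    trunc_fderiv_prolong (Nat.le_succ m) (contDiffAt_transition he hcm ho.1 ho.2)
  have hsS := shift_fderiv_prolong (isOpen_overlap e c) (contDiffOn_transition he hcm) ho
  have hsym := hψ.isSymmSndFDerivAt
    (by rw [minSmoothness_of_isRCLikeNormedField]; exact WithTop.coe_le_coe.2 le_top)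
  refine ContinuousLinearMap.ext fun v => ?_
  show formVal (tulczyjew η) p (fderiv ℝ (prolong (m + 1) f) y v) = _
  rw [hq]
  -- Both sides contain the second derivative of the change of coordinates, on the same two vectors
  -- in opposite orders. Its symmetry makes them agree.
  have hS := hsS v
  have hy2 := hsym.eq (shift E m y) (T v)
  simp only [add_apply, ContinuousLinearMap.comp_apply, hsT, hTy', hsh] at hS ⊢
  rw [hS, map_add, ← hy2]
  simp
  ring

theorem IsSmoothForm.tulczyjew {η : JetForm E Q m} (hη : IsSmoothForm η) :
    IsSmoothForm (tulczyjew η) := by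
  intro e he
  have hmaps : MapsTo (trunc E (Nat.le_succ m)) {y : Fin (m + 2) → E | y 0 ∈ e.target}
      {y | y 0 ∈ e.target} := fun y hy => hy
  have h1 := (hη e he).comp (trunc E (Nat.le_succ m)).contDiff.contDiffOn hmaps
  have h2 := ((hη e he).fderiv_of_isOpen (isOpen_preimage_apply_zero m e.open_target) (m := ∞)
    (by simp)).comp (trunc E (Nat.le_succ m)).contDiff.contDiffOn hmaps
  have h3 := ((h2.clm_apply (shift E m).contDiff.contDiffOn).clm_comp
    (contDiffOn_const (c := trunc E (Nat.le_succ m)))).add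
    (h1.clm_comp (contDiffOn_const (c := shift E m)))
  exact h3.congr fun y hy => localForm_tulczyjew hη he hy

theorem IsSmoothForm.tulczyjewIter {η : JetForm E Q m} (hη : IsSmoothForm η) (s : ℕ) :
    IsSmoothForm (tulczyjewIter η s) := by
  induction s with
  | zero => exact hη
  | succ s ih => exact ih.tulczyjew

theorem projFun_jetChart_symm (h : r ≤ m) (he : e ∈ atlas E Q) {y : Fin (m + 1) → E}
    (hy : y 0 ∈ e.target) :
    projFun h ((jetChart m e he).symm y) = (jetChart r e he).symm (trunc E h y) := by
  have hb := base_jetChart_symm_mem he hy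
  have hc := coord_projFun h he hb
  rw [coord_jetChart_symm_self he hy] at hc
  rw [← hc, jetChart_symm_coord he (by rwa [base_projFun])]

/-- Truncation represents the tangent map of the projection in every natural chart, because it
commutes with the changes of coordinates (`trunc_fderiv_prolong`). -/
theorem localForm_pullbackForm (h : r ≤ m) (η : JetForm E Q r) (he : e ∈ atlas E Q)
    {y : Fin (m + 1) → E} (hy : y 0 ∈ e.target) :
    localForm (pullbackForm h η) e he y = (localForm η e he (trunc E h y)).comp (trunc E h) := by
  have ho := mem_overlap_chartAt he hy
  unfold localForm
  rw [← projFun_jetChart_symm h he hy]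
  set p := (jetChart m e he).symm y
  unfold formAt
  rw [base_projFun]
  have hv : formVal (pullbackForm h η) p = (formVal η (projFun h p)).comp (trunc E h) := by
    rw [← mfderiv_proj h p]
    rfl
  rw [hv]
  refine ContinuousLinearMap.ext fun v => ?_
  exact congrArg (formVal η (projFun h p)) (trunc_fderiv_prolong h
    (contDiffAt_transition he (chart_mem_atlas E _) ho.1 ho.2) v)

theorem IsSmoothForm.pullbackForm (h : r ≤ m) {η : JetForm E Q r} (hη : IsSmoothForm η) :
    IsSmoothForm (pullbackForm h η) := by
  intro e he
  have h1 := (hη e he).comp (trunc E h).contDiff.contDiffOn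
    (show MapsTo (trunc E h) {y : Fin (m + 1) → E | y 0 ∈ e.target} {y | y 0 ∈ e.target} from
      fun y hy => hy)
  exact (h1.clm_comp (contDiffOn_const (c := trunc E h))).congr fun y hy =>
    localForm_pullbackForm h η he hy

/-- A smooth function on `T^m Q` is smooth in natural coordinates. -/
theorem contDiffOn_comp_jetChart_symm {f : HigherTangent m E Q → ℝ}
    (hf : ContMDiff 𝓘(ℝ, Fin (m + 1) → E) 𝓘(ℝ, ℝ) ∞ f) (he : e ∈ atlas E Q) :
    ContDiffOn ℝ ∞ (f ∘ (jetChart m e he).symm) {y | y 0 ∈ e.target} := by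
  have hg : (core E Q m).openPartialHomeomorph (jetChart m e he) ⟨e, he, rfl⟩ ∈
      atlas (Fin (m + 1) → E) (HigherTangent m E Q) := mem_atlas_iff.2 ⟨_, _, rfl⟩
  have h1 := contMDiffOn_symm_of_mem_maximalAtlas (I := 𝓘(ℝ, Fin (m + 1) → E)) (n := ∞)
    (IsManifold.subset_maximalAtlas hg)
  exact contMDiffOn_iff_contDiffOn.1 (hf.comp_contMDiffOn h1)

theorem formVal_verticalDifferential {f : HigherTangent m E Q → ℝ}
    (hf : ContMDiff 𝓘(ℝ, Fin (m + 1) → E) 𝓘(ℝ, ℝ) ∞ f) (r : ℕ) (p : HigherTangent m E Q) :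
    formVal (verticalDifferential r f) p =
      (fderiv ℝ (f ∘ (jetChart m (chartAt E (base p)) (chart_mem_atlas E _)).symm)
        (coord (chartAt E (base p)) p)).comp (verticalModel E m r) := by
  have h : mfderiv 𝓘(ℝ, Fin (m + 1) → E) 𝓘(ℝ, ℝ) f p =
      fderiv ℝ (f ∘ (jetChart m (chartAt E (base p)) (chart_mem_atlas E _)).symm)
        (coord (chartAt E (base p)) p) := by
    rw [(hf.mdifferentiable (by simp) p).mfderiv]
    simp only [modelWithCornersSelf_coe, range_id, fderivWithin_univ]
    rfl
  rw [← h]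
  rfl

/-- The differential of `f` transforms by the chain rule, and `J_r` has the same matrix in all
natural charts (`fderiv_prolong_verticalModel`). -/
theorem localForm_verticalDifferential {f : HigherTangent m E Q → ℝ}
    (hf : ContMDiff 𝓘(ℝ, Fin (m + 1) → E) 𝓘(ℝ, ℝ) ∞ f) (r : ℕ) (he : e ∈ atlas E Q)
    {y : Fin (m + 1) → E} (hy : y 0 ∈ e.target) :
    localForm (verticalDifferential r f) e he y =
      (fderiv ℝ (f ∘ (jetChart m e he).symm) y).comp (verticalModel E m r) := by
  have ho := mem_overlap_chartAt he hy
  unfold localForm formAt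
  rw [formVal_verticalDifferential hf]
  set c := chartAt E (base ((jetChart m e he).symm y))
  have hc : c ∈ atlas E Q := chart_mem_atlas E _
  rw [coord_jetChart_symm he hc ho]
  have hev : f ∘ (jetChart m e he).symm =ᶠ[𝓝 y]
      (f ∘ (jetChart m c hc).symm) ∘ prolong m (c ∘ e.symm) := by
    filter_upwards [(isOpen_preimage_apply_zero m (isOpen_overlap e c)).mem_nhds ho] with z hz
    simp only [Function.comp_apply]
    rw [jetChart_symm_prolong he hc hz]
  have h0 := (prolong_transition_zero_mem he hc ho ho).1
  have hd : DifferentiableAt ℝ (f ∘ (jetChart m c hc).symm) (prolong m (c ∘ e.symm) y) :=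
    ((contDiffOn_comp_jetChart_symm hf hc).contDiffAt
      ((isOpen_preimage_apply_zero m c.open_target).mem_nhds h0)).differentiableAt (by simp)
  rw [hev.fderiv_eq, fderiv_comp y hd
    ((contDiffAt_prolong_transition he hc ho).differentiableAt (by simp))]
  refine ContinuousLinearMap.ext fun v => ?_
  simp only [ContinuousLinearMap.comp_apply]
  rw [fderiv_prolong_verticalModel (isOpen_overlap e c) (contDiffOn_transition he hc) ho]

theorem isSmoothForm_verticalDifferential {f : HigherTangent m E Q → ℝ}
    (hf : ContMDiff 𝓘(ℝ, Fin (m + 1) → E) 𝓘(ℝ, ℝ) ∞ f) (r : ℕ) :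
    IsSmoothForm (verticalDifferential r f) := by
  intro e he
  have h1 := (contDiffOn_comp_jetChart_symm hf he).fderiv_of_isOpen
    (isOpen_preimage_apply_zero m e.open_target) (m := ∞) (by simp)
  exact (h1.clm_comp (contDiffOn_const (c := verticalModel E m r))).congr fun y hy =>
    localForm_verticalDifferential hf r he hy

variable {k : ℕ}

/-- The Lagrangian `1`-form is smooth. -/
theorem isSmoothForm_lagrangianForm (L : LagrangianFunction E Q k) :
    IsSmoothForm (lagrangianForm L) := by
  intro e he
  have h : ∀ s : Fin k, ContDiffOn ℝ ∞ (localForm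
      (pullbackForm (show k + (s : ℕ) ≤ 2 * k - 1 by have := s.2; omega)
        (tulczyjewIter (verticalDifferential ((s : ℕ) + 1) L) s)) e he) {y | y 0 ∈ e.target} :=
    fun s => ((isSmoothForm_verticalDifferential L.contMDiff _).tulczyjewIter s).pullbackForm _ e he
  have h1 := ContDiffOn.sum (s := Finset.univ) fun (s : Fin k) (_ : s ∈ Finset.univ) =>
    (contDiffOn_const (c := ((-1 : ℝ) ^ (s : ℕ) * (((s : ℕ) + 1).factorial : ℝ)⁻¹))).smul (h s)
  refine h1.congr fun y _ => ?_
  have hv : ∀ p, formVal (lagrangianForm L) p =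
      ∑ s : Fin k, ((-1 : ℝ) ^ (s : ℕ) * (((s : ℕ) + 1).factorial : ℝ)⁻¹) • formVal
        (pullbackForm (show k + (s : ℕ) ≤ 2 * k - 1 by have := s.2; omega)
          (tulczyjewIter (verticalDifferential ((s : ℕ) + 1) L) s)) p := fun _ => rfl
  unfold localForm formAt
  rw [hv]
  refine ContinuousLinearMap.ext fun v => ?_
  simp

end NaturalCharts

/-! ### Smoothness of the Legendre-Ostrogradsky map, and the integral curves. -/

section LegendreMap

variable {E : Type*} [NormedAddCommGroup E] [NormedSpace ℝ E]
  {Q : Type*} [TopologicalSpace Q] [ChartedSpace E Q] [IsManifold 𝓘(ℝ, E) ∞ Q] {k : ℕ}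

theorem trunc_extendZero {r m : ℕ} (h : r ≤ m) (v : Fin (r + 1) → E) :
    trunc E h (extendZero E r m v) = v := by
  refine funext fun i => ?_
  show (if h : (i : ℕ) < r + 1 then
    ContinuousLinearMap.proj (R := ℝ) (φ := fun _ => E) ⟨i, h⟩ else 0) v = v i
  rw [dif_pos i.2]
  rfl

/-- The inverse of the trivialization of the tangent bundle of `T^m Q` in natural coordinates. -/
theorem symmL_trivializationAt_higherTangent {m : ℕ} {q₀ q : HigherTangent m E Q}
    (hq : base q ∈ (chartAt E (base q₀)).source) :
    (trivializationAt (Fin (m + 1) → E) (TangentSpace 𝓘(ℝ, Fin (m + 1) → E)) q₀).symmL ℝ q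
      = fderiv ℝ (prolong m (chartAt E (base q) ∘ (chartAt E (base q₀)).symm))
          (coord (chartAt E (base q₀)) q) := by
  rw [TangentBundle.symmL_trivializationAt_eq_core (I := 𝓘(ℝ, Fin (m + 1) → E)) hq,
    tangentBundleCore_coordChange_achart]
  simp only [modelWithCornersSelf_coe, range_id, fderivWithin_univ]
  refine Filter.EventuallyEq.fderiv_eq ?_
  have he := chart_mem_atlas E (base q₀)
  have hy := (jetChart m (chartAt E (base q₀)) he).map_source hq
  have ho := mem_overlap_chartAt he hy
  change _ ∈ overlap _ (chartAt E (base ((jetChart m _ he).symm (coord _ q)))) at ho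
  rw [jetChart_symm_coord he hq] at ho
  filter_upwards [(isOpen_preimage_apply_zero m (isOpen_overlap _ _)).mem_nhds ho] with z hz
  exact coord_jetChart_symm he (chart_mem_atlas E _) hz

/-- The Legendre-Ostrogradsky map in natural coordinates. -/
theorem legendre_comp_fderiv_prolong (L : LagrangianFunction E Q k)
    {e : OpenPartialHomeomorph Q E} (he : e ∈ atlas E Q) {p : HigherTangent (2 * k - 1) E Q}
    (hp : base p ∈ e.source) :
    ((formVal (lagrangianForm L) p).comp (extendZero E (k - 1) (2 * k - 1))).comp
      (fderiv ℝ (prolong (k - 1) (chartAt E (base p) ∘ e.symm)) (coord e (rho E Q k p)))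
      = (localForm (lagrangianForm L) e he (coord e p)).comp
        (extendZero E (k - 1) (2 * k - 1)) := by
  have hy : coord e p 0 ∈ e.target := (jetChart (2 * k - 1) e he).map_source hp
  have hT : coord e (rho E Q k p) = trunc E (sub_one_le_two_mul_sub_one k) (coord e p) :=
    coord_projFun (sub_one_le_two_mul_sub_one k) he hp
  have ho := mem_overlap_chartAt he hy
  unfold localForm
  rw [jetChart_symm_coord he hp] at ho ⊢
  rw [hT]
  unfold formAt
  refine ContinuousLinearMap.ext fun v => ?_
  simp only [ContinuousLinearMap.comp_apply]
  set D := fderiv ℝ (prolong (2 * k - 1) (chartAt E (base p) ∘ e.symm)) (coord e p)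
  set D' := fderiv ℝ (prolong (k - 1) (chartAt E (base p) ∘ e.symm))
    (trunc E (sub_one_le_two_mul_sub_one k) (coord e p))
  -- Zero extension does not commute with changes of coordinates, but the discrepancy has vanishing
  -- truncation, and `θ_L` kills such vectors.
  have h0 : trunc E (sub_one_le_two_mul_sub_one k)
      (extendZero E (k - 1) (2 * k - 1) (D' v) - D (extendZero E (k - 1) (2 * k - 1) v)) = 0 := by
    rw [map_sub, trunc_extendZero, trunc_fderiv_prolong _
      (contDiffAt_transition he (chart_mem_atlas E _) ho.1 ho.2), trunc_extendZero, sub_self]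
  have h1 : formVal (lagrangianForm L) p
      (extendZero E (k - 1) (2 * k - 1) (D' v) - D (extendZero E (k - 1) (2 * k - 1) v)) = 0 :=
    lagrangianForm_eq_zero L p _ ((trunc_eq_zero (sub_one_le_two_mul_sub_one k)).1 h0)
  rw [map_sub] at h1
  exact sub_eq_zero.1 h1

/-- The Legendre-Ostrogradsky map is smooth. -/
theorem contMDiff_legendre (L : LagrangianFunction E Q k) :
    ContMDiff 𝓘(ℝ, Fin (2 * k - 1 + 1) → E) (phaseModel E k) ∞ (legendre L) := by
  intro p₀
  -- A cotangent space is a fibre of homomorphisms into the trivial line bundle. Smoothness thus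
  -- splits into that of the base map and that of the covector in the trivialization at `p₀`.
  refine (contMDiffAt_hom_bundle (E₂ := Bundle.Trivial (HigherTangent (k - 1) E Q) ℝ)
    (legendre L)).2 ⟨(rho E Q k).contMDiff p₀, ?_⟩
  set c := chartAt E (base p₀)
  have hcm : c ∈ atlas E Q := chart_mem_atlas E _
  have h1 : ContMDiffAt 𝓘(ℝ, Fin (2 * k - 1 + 1) → E) 𝓘(ℝ, Fin (2 * k - 1 + 1) → E) ∞
      (chartAt (Fin (2 * k - 1 + 1) → E) p₀) p₀ :=
    contMDiffAt_of_mem_maximalAtlas (IsManifold.chart_mem_maximalAtlas p₀) (mem_chart_source _ p₀)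
  have h2 : ContDiffAt ℝ ∞ (localForm (lagrangianForm L) c hcm) (coord c p₀) :=
    (isSmoothForm_lagrangianForm L).contDiffAt hcm
      ((jetChart (2 * k - 1) c hcm).map_source (mem_chart_source E (base p₀)))
  have h3 := (h2.clm_comp (contDiffAt_const (c := extendZero E (k - 1) (2 * k - 1)))).contMDiffAt
  have h4 := h3.comp p₀ h1
  refine h4.congr_of_eventuallyEq ?_
  filter_upwards [(chartAt (Fin (2 * k - 1 + 1) → E) p₀).open_source.mem_nhds
    (mem_chart_source _ p₀)] with p hp
  have hp' : base p ∈ c.source := hp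
  refine Eq.trans ?_ (legendre_comp_fderiv_prolong L hcm hp')
  have hr : base (rho E Q k p) ∈ (chartAt E (base (rho E Q k p₀))).source := by
    show base (projFun (sub_one_le_two_mul_sub_one k) p) ∈
      (chartAt E (base (projFun (sub_one_le_two_mul_sub_one k) p₀))).source
    rwa [base_projFun, base_projFun]
  have hs := symmL_trivializationAt_higherTangent hr
  -- A jet and its projection lie over the same point of `Q`, so the preferred charts upstairs and
  -- downstairs come from the same chart of `Q`.
  have hb : base (rho E Q k p) = base p := base_projFun (sub_one_le_two_mul_sub_one k) p
  have hb₀ : base (rho E Q k p₀) = base p₀ := base_projFun (sub_one_le_two_mul_sub_one k) p₀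
  rw [hb, hb₀] at hs
  rw [← hs]
  unfold ContinuousLinearMap.inCoordinates
  refine ContinuousLinearMap.ext fun v => ?_
  simp
  rfl

theorem contMDiff_pr1 : ContMDiff (unifiedModel E k) 𝓘(ℝ, Fin (2 * k - 1 + 1) → E) ∞
    (pr1 : Unified E Q k → HigherTangent (2 * k - 1) E Q) :=
  Bundle.contMDiff_proj _

theorem legendreGraph_pr1 (L : LagrangianFunction E Q k) {w : Unified E Q k}
    (hw : w ∈ graphSet L) : legendreGraph L (pr1 w) = w := by
  obtain ⟨p, α⟩ := w
  have h : pr2 ⟨p, α⟩ = legendre L p := hw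
  have h' : α = (legendre L p).2 := by
    injection h
  unfold legendreGraph pr1
  rw [h']

/-- The image by the Legendre-Ostrogradsky map of an integral curve of the unified dynamics is an
integral curve of the Hamiltonian vector field. -/
theorem isMIntegralCurveOn_legendre_comp (L : LagrangianFunction E Q k)
    {X : (w : Unified E Q k) → TangentSpace (unifiedModel E k) w}
    {Xh : (α : PhaseSpace E Q k) → TangentSpace (phaseModel E k) α}
    (hXh : IsLegendrePushforward L (lagrangianField L X) Xh) {I : Set ℝ} {σ : ℝ → Unified E Q k}
    (hσo : ∀ t ∈ I, σ t ∈ graphSet L) (hσ : IsMIntegralCurveOn σ X I) :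
    IsMIntegralCurveOn (fun t => legendre L (pr1 (σ t))) Xh I := by
  intro t ht
  have h1 := (contMDiff_pr1.mdifferentiable (by simp) (σ t)).hasMFDerivAt
  have h2 := ((contMDiff_legendre L).mdifferentiable (by simp) (pr1 (σ t))).hasMFDerivAt
  have h3 := (h2.comp (σ t) h1).comp_hasMFDerivWithinAt t (hσ t ht)
  have hw := legendreGraph_pr1 L (hσo t ht)
  have key : Xh (legendre L (pr1 (σ t))) =
      mfderiv 𝓘(ℝ, Fin (2 * k - 1 + 1) → E) (phaseModel E k) (legendre L) (pr1 (σ t))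
        (mfderiv (unifiedModel E k) 𝓘(ℝ, Fin (2 * k - 1 + 1) → E) pr1 (σ t) (X (σ t))) := by
    rw [hXh]
    unfold lagrangianField
    congr 1
    -- `X_L` is defined through `X` at the point of the graph over `pr1 (σ t)`; that point is `σ t`
    -- itself.
    rw [hw]
  rw [key]
  -- The derivative of a curve is a linear map on `ℝ`, so it suffices to compare values at `1`.
  refine h3.congr_mfderiv (ContinuousLinearMap.ext_ring ?_)
  change mfderiv 𝓘(ℝ, Fin (2 * k - 1 + 1) → E) (phaseModel E k) (legendre L) (pr1 (σ t))
    (mfderiv (unifiedModel E k) 𝓘(ℝ, Fin (2 * k - 1 + 1) → E) pr1 (σ t) ((1 : ℝ) • X (σ t))) =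
      (1 : ℝ) • mfderiv 𝓘(ℝ, Fin (2 * k - 1 + 1) → E) (phaseModel E k) (legendre L) (pr1 (σ t))
        (mfderiv (unifiedModel E k) 𝓘(ℝ, Fin (2 * k - 1 + 1) → E) pr1 (σ t) (X (σ t)))
  rw [one_smul, one_smul]

end LegendreMap

end HigherOrder

end

theorem mainTheorem7 (n k : ℕ) [NeZero k]
    (Q : Type*) [TopologicalSpace Q] [ChartedSpace (EuclideanSpace ℝ (Fin n)) Q]
    [IsManifold 𝓘(ℝ, EuclideanSpace ℝ (Fin n)) ∞ Q]
    (L : HigherOrder.LagrangianFunction (EuclideanSpace ℝ (Fin n)) Q k)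
    (X : (w : HigherOrder.Unified (EuclideanSpace ℝ (Fin n)) Q k) →
      TangentSpace (HigherOrder.unifiedModel (EuclideanSpace ℝ (Fin n)) k) w)
    (hX : HigherOrder.IsUnifiedSolution L X)
    (Xh : (α : HigherOrder.PhaseSpace (EuclideanSpace ℝ (Fin n)) Q k) →
      TangentSpace (HigherOrder.phaseModel (EuclideanSpace ℝ (Fin n)) k) α)
    (hXh : HigherOrder.IsLegendrePushforward L (HigherOrder.lagrangianField L X) Xh)
    (I : Set ℝ) (σ : ℝ → HigherOrder.Unified (EuclideanSpace ℝ (Fin n)) Q k)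
    (hσo : ∀ t ∈ I, σ t ∈ HigherOrder.graphSet L)
    (hσ : IsMIntegralCurveOn σ X I) :
    IsMIntegralCurveOn (fun t => HigherOrder.legendre L (HigherOrder.pr1 (σ t))) Xh I := by
  exact HigherOrder.isMIntegralCurveOn_legendre_comp L hXh hσo hσ
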